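/- **Models and minimax risk.** For $w\in\mathbb R^d$ the *Cardinal* model observes $y_i=w_{u(i)}+\varepsilon_i$, $i=1,\dots,n$, where $u(i)\in\{1,\dots,d\}$ is the fixed coordinate evaluated in the $i$-th measurement and the $\varepsilon_i$ are independent $N(0,\sigma_c^2)$, $\sigma_c>0$; every $w\in\mathcal W=\mathbb R^d$ is allowed. The *Thurstone* model observes $y_i=\operatorname{sign}(w_{a(i)}-w_{b(i)}+\varepsilon_i)\in\{-1,1\}$, where $(a(i),b(i))$, $a(i)\ne b(i)$, is the fixed pair compared in the $i$-th measurement and the $\varepsilon_i$ are independent $N(0,\sigma_o^2)$, $\sigma_o>0$; the allowed vectors are $\mathcal W=\{w\in\mathbb R^d:\sum_j w_j=0,\ \|w\|_\infty\le B\}$, with $B>0$ and $\sigma_o$ known. In each model let $\mathbb P_w$ be the law of $(y_1,\dots,y_n)$ and let $$\mathfrak M_n^2=\inf_{\hat w}\ \sup_{w\in\mathcal W}\ \mathbb E_{\mathbb P_w}\big[\|\hat w(y)-w\|_2^2\big],$$ the infimum being over all measurable maps $\hat w$ from the samples to $\mathcal W$. **Theorem.** (a) Let $d\ge1$, $n\ge1$,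 and suppose that in the Cardinal model each coordinate is observed exactly $n/d$ times. Then $$\frac{\mathfrak M_n^2(\text{Cardinal})}{d}=\frac{d\,\sigma_c^2}{n}.$$ (b) Let $d\ge2$, $n\ge1$, and suppose that in the Thurstone model each unordered pair of distinct items is compared exactly $n/\binom d2$ times. Let $\Phi$ be the standard Gaussian c.d.f. and $\kappa=\Phi(2B/\sigma_o)\,(1-\Phi(2B/\sigma_o))$. If $n$ is large enough, namely $n\ge \dfrac{\sigma_o^2\,\kappa\,(d-1)^2}{0.07\,B^2}$, then $$0.0008\,\kappa\,\frac{d\,\sigma_o^2}{n}\ \le\ \frac{\mathfrak M_n^2(\text{Thurstone})}{d}\ \le\ \frac{5}{\kappa^2}\,\frac{d\,\sigma_o^2}{n}.$$ -/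

import Mathlib

open MeasureTheory ProbabilityTheory

namespace CardinalOrdinal

/-- The sign of a real number as an element of `{-1, 1}` (ties, which have probability zero in the
model below, are resolved as `+1`). -/
noncomputable def sgn (t : ℝ) : ℤˣ := if 0 ≤ t then 1 else -1

/-- The coordinate vector with entry `1` at `j` and `0` elsewhere. -/
noncomputable def coordVec {d : ℕ} (j : Fin d) : EuclideanSpace ℝ (Fin d) :=
  EuclideanSpace.single j 1

/-- The differencing vector with entry `+1` at `a`, `-1` at `b` and `0` elsewhere (for `a ≠ b`). -/
noncomputable def diffVec {d : ℕ} (a b : Fin d) : EuclideanSpace ℝ (Fin d) :=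
  EuclideanSpace.single a 1 - EuclideanSpace.single b 1

/-- The law of `n` independent centered Gaussian noise variables with variance `σ ^ 2`. -/
noncomputable def noiseLaw (n : ℕ) (σ : ℝ) : Measure (Fin n → ℝ) :=
  Measure.pi fun _ => gaussianReal 0 ⟨σ ^ 2, sq_nonneg σ⟩

/-- The law of the observations `y i = ⟪w, e_{u i}⟫ + ε i`, where `u i` is the coordinate that is
evaluated in the `i`-th measurement. -/
noncomputable def cardinalLaw {d n : ℕ} (σ : ℝ) (u : Fin n → Fin d)
    (w : EuclideanSpace ℝ (Fin d)) : Measure (Fin n → ℝ) :=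
  (noiseLaw n σ).map fun ε i => inner ℝ w (coordVec (u i)) + ε i

/-- The law of the observations `y i = sign (⟪w, e_a - e_b⟫ + ε i)`, where `p i = (a, b)` is the
pair that is compared in the `i`-th measurement. -/
noncomputable def thurstoneLaw {d n : ℕ} (σ : ℝ) (p : Fin n → Fin d × Fin d)
    (w : EuclideanSpace ℝ (Fin d)) : Measure (Fin n → ℤˣ) :=
  (noiseLaw n σ).map fun ε i => sgn (inner ℝ w (diffVec (p i).1 (p i).2) + ε i)

/-- The minimax risk in squared Euclidean norm: the infimum over all measurable estimators with
values in the set `W` of allowed parameters, of the supremum over `w ∈ W` of the expected squared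
error when the samples have law `P w`. -/
noncomputable def minimaxSqRisk {d : ℕ} {Y : Type*} [MeasurableSpace Y]
    (W : Set (EuclideanSpace ℝ (Fin d))) (P : EuclideanSpace ℝ (Fin d) → Measure Y) : ENNReal :=
  ⨅ (est : Y → EuclideanSpace ℝ (Fin d)) (_ : Measurable est) (_ : ∀ y, est y ∈ W),
    ⨆ w ∈ W, ∫⁻ y, ENNReal.ofReal (‖est y - w‖ ^ 2) ∂(P w)

/-- The minimax risk of the Cardinal model; every vector is allowed. -/
noncomputable def cardinalRisk {d n : ℕ} (σ : ℝ) (u : Fin n → Fin d) : ENNReal :=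
  minimaxSqRisk Set.univ (cardinalLaw σ u)

/-- The allowed vectors of the Thurstone model: entries sum to `0` and are bounded by `B`. -/
def thurstoneSet (d : ℕ) (B : ℝ) : Set (EuclideanSpace ℝ (Fin d)) :=
  {w | ∑ j, w j = 0 ∧ ∀ j, |w j| ≤ B}

/-- The minimax risk of the Thurstone model with known `σ` and `B`. -/
noncomputable def thurstoneRisk {d n : ℕ} (σ B : ℝ) (p : Fin n → Fin d × Fin d) : ENNReal :=
  minimaxSqRisk (thurstoneSet d B) (thurstoneLaw σ p)

/-- Every coordinate is evaluated exactly `n / d` times. -/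
def IsUniformCoordDesign {d n : ℕ} (u : Fin n → Fin d) : Prop :=
  ∀ j, ((Finset.univ.filter fun i => u i = j).card : ℝ) = n / d

/-- Every measurement compares two distinct items, and every unordered pair of distinct items is
compared exactly `n / (d choose 2)` times. -/
def IsUniformPairDesign {d n : ℕ} (p : Fin n → Fin d × Fin d) : Prop :=
  (∀ i, (p i).1 ≠ (p i).2) ∧
    ∀ j k, j ≠ k →
      ((Finset.univ.filter fun i => s((p i).1, (p i).2) = s(j, k)).card : ℝ) = n / (d.choose 2)

/-- The standard Gaussian cumulative distribution function. -/
noncomputable def gaussCDF (t : ℝ) : ℝ := cdf (gaussianReal 0 1) t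

/-- `κ = Φ(2B/σ) (1 - Φ(2B/σ))`. -/
noncomputable def kappa (B σ : ℝ) : ℝ :=
  gaussCDF (2 * B / σ) * (1 - gaussCDF (2 * B / σ))

end CardinalOrdinal

/-! Cardinal model. The vector of sample means is unbiased with the same risk at every `w`, which
gives the upper bound. For the lower bound, a Gaussian prior `N(0, τ²)` on each coordinate bounds
the minimax risk below by a Bayes risk. The residual of a coordinate after its posterior mean is
uncorrelated with every observation, hence independent of the data by joint Gaussianity, so no
estimator beats its variance `σ²τ²/((n/d)τ² + σ²)` (`le_lintegral_bayes_coord`). Letting `τ → ∞`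
gives the exact constant.

Thurstone model, upper bound. The estimator minimizes a potential whose gradient compares predicted
with observed wins; it is used only through its first-order condition on the convex constraint set.
Since `Φ` is strongly monotone on the relevant interval, with a constant proportional to `κ`, the
squared error is controlled by the score noise (`sq_dist_le_of_variational`), whose second moment is
at most `n/2`. The uniform design enters because its quadratic form is a multiple of the squared
norm on sum-zero vectors.

Thurstone model, lower bound. This is Assouad's method on a hypercube of sum-zero vectors. Flipping
one sign changes the law so little that the Hellinger affinity stays above `2/3`, and two such laws
cannot both be estimated well (`two_point_lower_bound`). Averaging over the cube and summing over
coordinates yields a bad parameter. -/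

namespace CardinalOrdinal

/-! ### Quantitative bounds on the Gaussian distribution function -/

section GaussianCDF

lemma gaussCDF_eq_integral (x : ℝ) :
    gaussCDF x = ∫ t in Set.Iic x, gaussianPDFReal 0 1 t := by
  rw [gaussCDF, cdf_eq_real, measureReal_def, gaussianReal_apply_eq_integral 0 one_ne_zero,
    ENNReal.toReal_ofReal (integral_nonneg fun t => gaussianPDFReal_nonneg 0 1 t)]

lemma gaussianPDFReal_zero_one (x : ℝ) :
    gaussianPDFReal 0 1 x = (√(2 * Real.pi))⁻¹ * Real.exp (-x ^ 2 / 2) := by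
  simp [gaussianPDFReal]

lemma continuous_gaussianPDFReal_zero_one : Continuous (gaussianPDFReal 0 1) := by
  have : gaussianPDFReal 0 1 = fun x => (√(2 * Real.pi))⁻¹ * Real.exp (-x ^ 2 / 2) :=
    funext gaussianPDFReal_zero_one
  rw [this]
  fun_prop

lemma hasDerivAt_gaussCDF (x : ℝ) : HasDerivAt gaussCDF (gaussianPDFReal 0 1 x) x := by
  have hint : ∀ a : ℝ, IntegrableOn (gaussianPDFReal 0 1) (Set.Iic a) :=
    fun a => (integrable_gaussianPDFReal 0 1).integrableOn
  have h : gaussCDF = fun y => gaussCDF 0 + ∫ t in (0 : ℝ)..y, gaussianPDFReal 0 1 t := by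
    funext y
    rw [← intervalIntegral.integral_Iic_sub_Iic (hint 0) (hint y), ← gaussCDF_eq_integral,
      ← gaussCDF_eq_integral]
    ring
  rw [h]
  refine HasDerivAt.const_add _ ?_
  exact intervalIntegral.integral_hasDerivAt_right
    (continuous_gaussianPDFReal_zero_one.intervalIntegrable _ _)
    (continuous_gaussianPDFReal_zero_one.stronglyMeasurableAtFilter _ _)
    continuous_gaussianPDFReal_zero_one.continuousAt

lemma continuous_gaussCDF : Continuous gaussCDF :=
  continuous_iff_continuousAt.2 fun x => (hasDerivAt_gaussCDF x).continuousAt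

lemma strictMono_gaussCDF : StrictMono gaussCDF :=
  strictMono_of_hasDerivAt_pos hasDerivAt_gaussCDF
    fun x => gaussianPDFReal_pos 0 1 x one_ne_zero

lemma gaussCDF_pos (x : ℝ) : 0 < gaussCDF x :=
  (cdf_nonneg (gaussianReal 0 1) (x - 1)).trans_lt (strictMono_gaussCDF (by linarith))

lemma gaussCDF_lt_one (x : ℝ) : gaussCDF x < 1 :=
  (strictMono_gaussCDF (lt_add_one x)).trans_le (cdf_le_one (gaussianReal 0 1) (x + 1))

lemma one_sub_gaussCDF_eq_real_Ici (x : ℝ) :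
    1 - gaussCDF x = (gaussianReal 0 1).real (Set.Ici x) := by
  have := nullSingletonClass_gaussianReal (μ := 0) (v := 1) one_ne_zero
  rw [gaussCDF, cdf_eq_real, ← probReal_compl_eq_one_sub measurableSet_Iic, Set.compl_Iic,
    measureReal_congr Ioi_ae_eq_Ici]

lemma gaussCDF_neg (x : ℝ) : gaussCDF (-x) = 1 - gaussCDF x := by
  have h : (gaussianReal 0 1).map (fun y => -y) = gaussianReal 0 1 := by
    simpa using gaussianReal_map_neg (μ := 0) (v := 1)
  have hs : (fun y : ℝ => -y) ⁻¹' Set.Iic (-x) = Set.Ici x := by ext; simp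
  rw [one_sub_gaussCDF_eq_real_Ici, gaussCDF, cdf_eq_real, ← hs,
    ← map_measureReal_apply measurable_neg measurableSet_Iic, h]

/-- The variance `σ ^ 2` of the noise as a nonnegative real number. -/
noncomputable def noiseVar (σ : ℝ) : NNReal := ⟨σ ^ 2, sq_nonneg σ⟩

@[simp] lemma coe_noiseVar (σ : ℝ) : (noiseVar σ : ℝ) = σ ^ 2 := rfl

lemma noiseLaw_eq_pi (n : ℕ) (σ : ℝ) :
    noiseLaw n σ = Measure.pi fun _ => gaussianReal 0 (noiseVar σ) := rfl

lemma gaussianReal_Ici_neg {σ : ℝ} (hσ : 0 < σ) (x : ℝ) :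
    gaussianReal 0 (noiseVar σ) {ε | 0 ≤ x + ε} = ENNReal.ofReal (gaussCDF (x / σ)) := by
  -- The negative scale turns the upper-tail event into the lower tail that the distribution
  -- function measures.
  have h : (gaussianReal 0 1).map (fun y => (-σ) * y) = gaussianReal 0 (noiseVar σ) := by
    rw [gaussianReal_map_const_mul]
    congr 1
    · simp
    · ext; simp
  rw [← h, Measure.map_apply (by fun_prop) (measurableSet_le (by fun_prop) (by fun_prop)),
    gaussCDF, ofReal_cdf]
  congr 1
  ext y
  simp only [Set.mem_preimage, Set.mem_ofPred_eq, Set.mem_Iic]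
  rw [le_div_iff₀ hσ]
  constructor <;> intro h <;> linarith

lemma one_sub_gaussCDF_le_exp {t : ℝ} (ht : 0 ≤ t) :
    1 - gaussCDF t ≤ Real.exp (-t ^ 2 / 2) := by
  rw [one_sub_gaussCDF_eq_real_Ici]
  have h := measure_ge_le_exp_mul_mgf (X := id) (μ := gaussianReal 0 1) t ht
    (integrable_exp_mul_gaussianReal t)
  rw [mgf_id_gaussianReal] at h
  refine (show (gaussianReal 0 1).real (Set.Ici t) ≤ _ from h).trans (le_of_eq ?_)
  rw [← Real.exp_add]
  congr 1
  simp
  ring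

/-- By symmetry `Φ(x)` lies in `[1 - Φ(t), Φ(t)]`, and the concave function `q (1 - q)` is smallest
at the endpoints, where it takes the same value. -/
lemma gaussCDF_mul_one_sub_le {x t : ℝ} (hx : |x| ≤ t) :
    gaussCDF t * (1 - gaussCDF t) ≤ gaussCDF x * (1 - gaussCDF x) := by
  have h1 := strictMono_gaussCDF.monotone (abs_le.1 hx).1
  have h2 := strictMono_gaussCDF.monotone (abs_le.1 hx).2
  rw [gaussCDF_neg] at h1
  nlinarith

lemma six_le_two_mul_pi : (6 : ℝ) ≤ 2 * Real.pi := by linarith [Real.pi_gt_three]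

lemma gaussianPDFReal_sq_le (x : ℝ) : gaussianPDFReal 0 1 x ^ 2 ≤ 1 / 6 := by
  rw [gaussianPDFReal_zero_one, mul_pow, inv_pow, Real.sq_sqrt (by positivity), ← Real.exp_nat_mul]
  have h1 : Real.exp ((2 : ℕ) * (-x ^ 2 / 2)) ≤ 1 := by
    rw [Real.exp_le_one_iff]; push_cast; nlinarith [sq_nonneg x]
  have h2 : (2 * Real.pi)⁻¹ ≤ 1 / 6 := by
    rw [one_div]; exact inv_anti₀ (by norm_num) six_le_two_mul_pi
  exact (mul_le_mul h2 h1 (Real.exp_nonneg _) (by norm_num)).trans (by norm_num)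

/-- The density is at most `1/√(2π) ≤ 1/√6`, so `Φ` is Lipschitz with that constant. -/
lemma gaussCDF_sub_sq_le (x y : ℝ) : (gaussCDF x - gaussCDF y) ^ 2 ≤ (x - y) ^ 2 / 6 := by
  have h := Convex.norm_image_sub_le_of_norm_hasDerivWithin_le (f := gaussCDF)
    (C := √(1 / 6)) (s := Set.univ) (x := y) (y := x)
    (fun z _ => (hasDerivAt_gaussCDF z).hasDerivWithinAt)
    (fun z _ => by
      rw [Real.norm_eq_abs]
      exact Real.abs_le_sqrt (gaussianPDFReal_sq_le z)) convex_univ trivial trivial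
  rw [Real.norm_eq_abs, Real.norm_eq_abs] at h
  have h2 := pow_le_pow_left₀ (abs_nonneg _) h 2
  rw [mul_pow, Real.sq_sqrt (by norm_num), sq_abs, sq_abs] at h2
  linarith

/-- The Chernoff bound dominates the tail `1 - Φ(t)` by `exp(-t²/2) ≤ exp(-x²/2)`, which is the
density at `x` up to the factor `√(2π) ≤ 3`. -/
lemma gaussCDF_mul_one_sub_le_pdf {x t : ℝ} (hx : |x| ≤ t) :
    gaussCDF t * (1 - gaussCDF t) / 3 ≤ gaussianPDFReal 0 1 x := by
  have ht : 0 ≤ t := (abs_nonneg x).trans hx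
  have h1 : gaussCDF t * (1 - gaussCDF t) ≤ Real.exp (-t ^ 2 / 2) :=
    (mul_le_of_le_one_left (by linarith [gaussCDF_lt_one t]) (gaussCDF_lt_one t).le).trans
      (one_sub_gaussCDF_le_exp ht)
  have h2 : Real.exp (-t ^ 2 / 2) ≤ Real.exp (-x ^ 2 / 2) := by
    have := sq_le_sq.2 (hx.trans (le_abs_self t))
    gcongr
  have h3 : (1 / 3 : ℝ) ≤ (√(2 * Real.pi))⁻¹ := by
    rw [one_div]
    refine inv_anti₀ (by positivity) ?_
    rw [Real.sqrt_le_left (by norm_num)]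
    nlinarith [Real.pi_lt_four]
  rw [gaussianPDFReal_zero_one]
  calc _ ≤ 1 / 3 * Real.exp (-x ^ 2 / 2) := by linarith
    _ ≤ _ := by gcongr

/-- Strong monotonicity of `Φ` on `[-t, t]`, by the mean value theorem and the lower bound on the
density. It makes the comparison model identifiable at a quantitative rate. -/
lemma mul_sq_le_gaussCDF_sub_mul_sub {x y t : ℝ} (hx : |x| ≤ t) (hy : |y| ≤ t) :
    gaussCDF t * (1 - gaussCDF t) / 3 * (x - y) ^ 2 ≤ (gaussCDF x - gaussCDF y) * (x - y) := by
  wlog hxy : y ≤ x generalizing x y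
  · have := this hy hx (le_of_not_ge hxy)
    linarith
  have h := (convex_Icc (-t) t).mul_sub_le_image_sub_of_le_deriv (f := gaussCDF)
    continuous_gaussCDF.continuousOn
    (fun z _ => (hasDerivAt_gaussCDF z).differentiableAt.differentiableWithinAt)
    (C := gaussCDF t * (1 - gaussCDF t) / 3)
    (fun z hz => by
      rw [(hasDerivAt_gaussCDF z).deriv]
      exact gaussCDF_mul_one_sub_le_pdf (abs_le.2 (Set.mem_Icc.1 (interior_subset hz))))
    y (abs_le.1 hy) x (abs_le.1 hx) hxy
  nlinarith

lemma kappa_pos (B σ : ℝ) : 0 < kappa B σ :=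
  mul_pos (gaussCDF_pos _) (by linarith [gaussCDF_lt_one (2 * B / σ)])

end GaussianCDF

/-! ### The Thurstone observations as a finite product of sign laws -/

section ThurstoneLaw

instance : MeasurableSingletonClass ℤˣ where
  measurableSet_singleton a := ⟨{(a : ℤ)}, measurableSet_singleton _, by ext; simp [Units.ext_iff]⟩

lemma inner_coordVec {d : ℕ} (w : EuclideanSpace ℝ (Fin d)) (j : Fin d) :
    inner ℝ w (coordVec j) = w j := by
  simp [coordVec, EuclideanSpace.inner_single_right]

lemma inner_diffVec {d : ℕ} (w : EuclideanSpace ℝ (Fin d)) (a b : Fin d) :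
    inner ℝ w (diffVec a b) = w a - w b := by
  simp [diffVec, inner_sub_right, EuclideanSpace.inner_single_right]

/-- The probability mass function of a sign that equals `1` with probability `q`. -/
noncomputable def signPMF (q : ℝ) (y : ℤˣ) : ℝ := if y = 1 then q else 1 - q

lemma sum_units_int {M : Type*} [AddCommMonoid M] (f : ℤˣ → M) : ∑ y, f y = f 1 + f (-1) := by
  rw [show (Finset.univ : Finset ℤˣ) = {1, -1} from rfl, Finset.sum_pair (by decide)]

@[simp] lemma signPMF_one (q : ℝ) : signPMF q 1 = q := if_pos rfl

@[simp] lemma signPMF_neg_one (q : ℝ) : signPMF q (-1) = 1 - q := if_neg (by decide)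

lemma signPMF_nonneg {q : ℝ} (h0 : 0 ≤ q) (h1 : q ≤ 1) (y : ℤˣ) : 0 ≤ signPMF q y := by
  unfold signPMF; split_ifs <;> linarith

lemma signPMF_gaussCDF_nonneg (x : ℝ) (y : ℤˣ) : 0 ≤ signPMF (gaussCDF x) y :=
  signPMF_nonneg (gaussCDF_pos x).le (gaussCDF_lt_one x).le y

lemma measurable_sgn : Measurable sgn :=
  Measurable.ite measurableSet_Ici measurable_const measurable_const

/-- The law of a single comparison with mean difference `x`. -/
noncomputable def signLaw (σ x : ℝ) : Measure ℤˣ :=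
  (gaussianReal 0 (noiseVar σ)).map fun ε => sgn (x + ε)

instance (σ x : ℝ) : IsProbabilityMeasure (signLaw σ x) :=
  Measure.isProbabilityMeasure_map (measurable_sgn.comp (by fun_prop)).aemeasurable

lemma signLaw_one {σ : ℝ} (hσ : 0 < σ) (x : ℝ) :
    signLaw σ x {1} = ENNReal.ofReal (gaussCDF (x / σ)) := by
  rw [signLaw, Measure.map_apply (f := fun ε => sgn (x + ε)) (measurable_sgn.comp (by fun_prop))
    (measurableSet_singleton _), ← gaussianReal_Ici_neg hσ]
  congr 1
  ext ε
  simp only [Set.mem_preimage, Set.mem_singleton_iff, Set.mem_ofPred_eq, sgn]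
  split_ifs with h
  · simp [h]
  · simp [h]

lemma signLaw_singleton {σ : ℝ} (hσ : 0 < σ) (x : ℝ) (y : ℤˣ) :
    signLaw σ x {y} = ENNReal.ofReal (signPMF (gaussCDF (x / σ)) y) := by
  rcases Int.units_eq_one_or y with rfl | rfl
  · rw [signLaw_one hσ, signPMF_one]
  · rw [signPMF_neg_one, show ({-1} : Set ℤˣ) = {1}ᶜ from by
      ext y; rcases Int.units_eq_one_or y with rfl | rfl <;> decide,
      prob_compl_eq_one_sub (measurableSet_singleton _), signLaw_one hσ,
      ENNReal.ofReal_sub _ (gaussCDF_pos _).le, ENNReal.ofReal_one]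

lemma thurstoneLaw_eq_pi {d n : ℕ} (σ : ℝ) (p : Fin n → Fin d × Fin d)
    (w : EuclideanSpace ℝ (Fin d)) :
    thurstoneLaw σ p w = Measure.pi fun i => signLaw σ (w (p i).1 - w (p i).2) := by
  simp only [thurstoneLaw, noiseLaw_eq_pi, inner_diffVec]
  have hm : ∀ i, Measurable fun ε : ℝ => sgn (w (p i).1 - w (p i).2 + ε) :=
    fun i => measurable_sgn.comp (by fun_prop)
  have : ∀ i, SigmaFinite ((gaussianReal 0 (noiseVar σ)).map
      fun ε : ℝ => sgn (w (p i).1 - w (p i).2 + ε)) := fun i =>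
    have := Measure.isProbabilityMeasure_map (μ := gaussianReal 0 (noiseVar σ))
      (hm i).aemeasurable
    inferInstance
  exact Measure.pi_map_pi (μ := fun _ => gaussianReal 0 (noiseVar σ))
    (f := fun i ε => sgn (w (p i).1 - w (p i).2 + ε)) fun i => (hm i).aemeasurable

instance {d n : ℕ} (σ : ℝ) (p : Fin n → Fin d × Fin d) (w : EuclideanSpace ℝ (Fin d)) :
    IsProbabilityMeasure (thurstoneLaw σ p w) := by
  rw [thurstoneLaw_eq_pi]; infer_instance

/-- The probability mass function of the Thurstone observations. -/
noncomputable def thurstonePMF {d n : ℕ} (σ : ℝ) (p : Fin n → Fin d × Fin d)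
    (w : EuclideanSpace ℝ (Fin d)) (y : Fin n → ℤˣ) : ℝ :=
  ∏ i, signPMF (gaussCDF ((w (p i).1 - w (p i).2) / σ)) (y i)

lemma thurstonePMF_nonneg {d n : ℕ} (σ : ℝ) (p : Fin n → Fin d × Fin d)
    (w : EuclideanSpace ℝ (Fin d)) (y : Fin n → ℤˣ) : 0 ≤ thurstonePMF σ p w y :=
  Finset.prod_nonneg fun _ _ => signPMF_gaussCDF_nonneg _ _

lemma sum_prod_signPMF {n : ℕ} (f : Fin n → ℤˣ → ℝ) :
    ∑ y : Fin n → ℤˣ, ∏ i, f i (y i) = ∏ i, (f i 1 + f i (-1)) := by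
  simp_rw [← sum_units_int, Finset.prod_univ_sum, Fintype.piFinset_univ]

lemma sum_thurstonePMF {d n : ℕ} (σ : ℝ) (p : Fin n → Fin d × Fin d)
    (w : EuclideanSpace ℝ (Fin d)) : ∑ y, thurstonePMF σ p w y = 1 := by
  simp [thurstonePMF, sum_prod_signPMF fun i => signPMF (gaussCDF ((w (p i).1 - w (p i).2) / σ))]

lemma thurstoneLaw_singleton {d n : ℕ} {σ : ℝ} (hσ : 0 < σ) (p : Fin n → Fin d × Fin d)
    (w : EuclideanSpace ℝ (Fin d)) (y : Fin n → ℤˣ) :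
    thurstoneLaw σ p w {y} = ENNReal.ofReal (thurstonePMF σ p w y) := by
  rw [thurstoneLaw_eq_pi, Measure.pi_singleton, thurstonePMF,
    ENNReal.ofReal_prod_of_nonneg fun _ _ => signPMF_gaussCDF_nonneg _ _]
  simp_rw [signLaw_singleton hσ]

lemma lintegral_thurstoneLaw {d n : ℕ} {σ : ℝ} (hσ : 0 < σ) (p : Fin n → Fin d × Fin d)
    (w : EuclideanSpace ℝ (Fin d)) (f : (Fin n → ℤˣ) → ℝ) (hf : ∀ y, 0 ≤ f y) :
    ∫⁻ y, ENNReal.ofReal (f y) ∂(thurstoneLaw σ p w) =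
      ENNReal.ofReal (∑ y, thurstonePMF σ p w y * f y) := by
  rw [lintegral_fintype, ENNReal.ofReal_sum_of_nonneg
    fun y _ => mul_nonneg (thurstonePMF_nonneg σ p w y) (hf y)]
  refine Finset.sum_congr rfl fun y _ => ?_
  rw [thurstoneLaw_singleton hσ, ENNReal.ofReal_mul (thurstonePMF_nonneg σ p w y), mul_comm]

lemma integral_signLaw {σ : ℝ} (hσ : 0 < σ) (x : ℝ) (f : ℤˣ → ℝ) :
    ∫ y, f y ∂(signLaw σ x) = gaussCDF (x / σ) * f 1 + (1 - gaussCDF (x / σ)) * f (-1) := by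
  rw [integral_fintype (Integrable.of_finite), sum_units_int]
  simp only [measureReal_def, signLaw_singleton hσ, signPMF_one, signPMF_neg_one, smul_eq_mul]
  rw [ENNReal.toReal_ofReal (gaussCDF_pos _).le,
    ENNReal.toReal_ofReal (by linarith [gaussCDF_lt_one (x / σ)])]

end ThurstoneLaw

/-! ### Sums over a uniform comparison design -/

section PairDesign

variable {d n : ℕ}

lemma sum_sum_sub_sq (v : Fin d → ℝ) :
    ∑ j, ∑ k, (v j - v k) ^ 2 = 2 * (d * ∑ j, v j ^ 2 - (∑ j, v j) ^ 2) := by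
  have h : ∀ j k, (v j - v k) ^ 2 = v j ^ 2 + v k ^ 2 - 2 * (v j * v k) := fun j k => by ring
  simp_rw [h, Finset.sum_sub_distrib, Finset.sum_add_distrib, ← Finset.mul_sum, ← Finset.sum_mul]
  simp [← Finset.mul_sum]
  ring

/-- Each unordered pair occurs twice among ordered pairs, hence the factor 2. The diagonal must
vanish because an item is never compared with itself. -/
lemma two_mul_sum_eq_of_isUniformPairDesign {p : Fin n → Fin d × Fin d}
    (hp : IsUniformPairDesign p) (g : Fin d → Fin d → ℝ) (hsymm : ∀ j k, g j k = g k j)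
    (hdiag : ∀ j, g j j = 0) :
    2 * ∑ i, g (p i).1 (p i).2 = n / (d.choose 2) * ∑ j, ∑ k, g j k := by
  have key : ∀ j k, n / (d.choose 2) * g j k =
      ∑ i, if s((p i).1, (p i).2) = s(j, k) then g j k else 0 := by
    intro j k
    by_cases hjk : j = k
    · subst hjk; simp [hdiag]
    · rw [← hp.2 j k hjk, ← Finset.sum_filter, Finset.sum_const, nsmul_eq_mul]
  simp_rw [Finset.mul_sum, key]
  have step : ∀ j, ∑ k, ∑ i, (if s((p i).1, (p i).2) = s(j, k) then g j k else 0) =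
      ∑ i, ∑ k, (if s((p i).1, (p i).2) = s(j, k) then g j k else 0) :=
    fun j => Finset.sum_comm
  simp_rw [step]
  rw [Finset.sum_comm]
  refine Finset.sum_congr rfl fun i _ => ?_
  have hne := hp.1 i
  generalize (p i).1 = a, (p i).2 = b at hne ⊢
  -- The comparison of `a` with `b` matches exactly the two ordered pairs `(a, b)` and `(b, a)`,
  -- which are distinct since `a ≠ b`.
  have split : ∀ j k, (if s(a, b) = s(j, k) then g j k else 0) =
      (if j = a then if k = b then g a b else 0 else 0) +
        if j = b then if k = a then g a b else 0 else 0 := by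
    intro j k
    simp only [Sym2.eq_iff]
    by_cases h1 : a = j ∧ b = k
    · obtain ⟨rfl, rfl⟩ := h1; simp [hne]
    · by_cases h2 : a = k ∧ b = j
      · obtain ⟨rfl, rfl⟩ := h2; simp [hne.symm, hsymm]
      · rw [if_neg (by tauto), ← ite_and, ← ite_and, if_neg (by grind), if_neg (by grind), add_zero]
  simp only [split, Finset.sum_add_distrib]
  simp [two_mul]

lemma sum_sub_sq_eq_of_isUniformPairDesign {p : Fin n → Fin d × Fin d}
    (hp : IsUniformPairDesign p) (v : Fin d → ℝ) :
    ∑ i, (v (p i).1 - v (p i).2) ^ 2 =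
      n / (d.choose 2) * (d * ∑ j, v j ^ 2 - (∑ j, v j) ^ 2) := by
  have h := two_mul_sum_eq_of_isUniformPairDesign hp (fun j k => (v j - v k) ^ 2)
    (fun j k => by ring) (fun j => by ring)
  rw [sum_sum_sub_sq] at h
  linarith

lemma sum_sub_sq_eq_of_sum_eq_zero {p : Fin n → Fin d × Fin d} (hd : 2 ≤ d)
    (hp : IsUniformPairDesign p) (v : Fin d → ℝ) (hv : ∑ j, v j = 0) :
    ∑ i, (v (p i).1 - v (p i).2) ^ 2 = 2 * n / (d - 1) * ∑ j, v j ^ 2 := by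
  have hd' : (2 : ℝ) ≤ d := by exact_mod_cast hd
  have h1 : (d : ℝ) - 1 ≠ 0 := by linarith
  rw [sum_sub_sq_eq_of_isUniformPairDesign hp, hv, Nat.cast_choose_two]
  field_simp
  ring

end PairDesign

/-! ### The estimator and its deterministic error bound -/

section VariationalEstimator

variable {d n : ℕ}

lemma isCompact_thurstoneSet (d : ℕ) (B : ℝ) : IsCompact (thurstoneSet d B) := by
  refine Metric.isCompact_of_isClosed_isBounded ?_ ?_
  · have : thurstoneSet d B = {w | ∑ j, w j = 0} ∩ ⋂ j, {w | |w j| ≤ B} := by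
      ext w; simp [thurstoneSet]
    rw [this]
    exact (isClosed_eq (by fun_prop) (by fun_prop)).inter
      (isClosed_iInter fun j => isClosed_le (by fun_prop) (by fun_prop))
  · rw [isBounded_iff_forall_norm_le]
    refine ⟨√(∑ _j : Fin d, B ^ 2), fun w hw => ?_⟩
    rw [EuclideanSpace.norm_eq]
    refine Real.sqrt_le_sqrt (Finset.sum_le_sum fun j _ => ?_)
    rw [Real.norm_eq_abs]
    exact pow_le_pow_left₀ (abs_nonneg _) (hw.2 j) 2

lemma convex_thurstoneSet (d : ℕ) (B : ℝ) : Convex ℝ (thurstoneSet d B) := by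
  intro v hv w hw s t hs ht hst
  refine ⟨?_, fun j => ?_⟩
  · simp [Finset.sum_add_distrib, ← Finset.mul_sum, hv.1, hw.1]
  · have h1 : |s * v j + t * w j| ≤ s * B + t * B := by
      refine (abs_add_le _ _).trans ?_
      rw [abs_mul, abs_mul, abs_of_nonneg hs, abs_of_nonneg ht]
      exact add_le_add (mul_le_mul_of_nonneg_left (hv.2 j) hs)
        (mul_le_mul_of_nonneg_left (hw.2 j) ht)
    rw [← add_mul, hst, one_mul] at h1
    simpa using h1

lemma zero_mem_thurstoneSet (d : ℕ) {B : ℝ} (hB : 0 ≤ B) : 0 ∈ thurstoneSet d B :=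
  ⟨by simp, fun j => by simpa using hB⟩

lemma abs_sub_div_le_of_mem_thurstoneSet {B σ : ℝ} (hσ : 0 < σ) {w : EuclideanSpace ℝ (Fin d)}
    (hw : w ∈ thurstoneSet d B) (a b : Fin d) : |(w a - w b) / σ| ≤ 2 * B / σ := by
  rw [abs_div, abs_of_pos hσ]
  gcongr
  have := abs_sub (w a) (w b)
  linarith [hw.2 a, hw.2 b]

/-- The inequality is the first-order optimality condition for minimizing, over the compact convex
parameter set, a potential built from an antiderivative of `Φ(·/σ)`. Convexity of the potential
itself is not needed. -/
lemma exists_variational_solution (σ : ℝ) {B : ℝ} (hB : 0 ≤ B)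
    (p : Fin n → Fin d × Fin d) (z : Fin n → ℝ) :
    ∃ x ∈ thurstoneSet d B, ∀ v ∈ thurstoneSet d B,
      0 ≤ ∑ i, (gaussCDF ((x (p i).1 - x (p i).2) / σ) - z i) *
        ((v (p i).1 - v (p i).2) - (x (p i).1 - x (p i).2)) := by
  set G : ℝ → ℝ := fun s => ∫ u in (0 : ℝ)..s, gaussCDF (u / σ) with hG
  have hcont : Continuous fun u : ℝ => gaussCDF (u / σ) :=
    continuous_gaussCDF.comp (by fun_prop)
  have hderiv : ∀ s, HasDerivAt G (gaussCDF (s / σ)) s := fun s =>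
    intervalIntegral.integral_hasDerivAt_right (hcont.intervalIntegrable _ _)
      (hcont.stronglyMeasurableAtFilter _ _) hcont.continuousAt
  have hGc : Continuous G := continuous_iff_continuousAt.2 fun s => (hderiv s).continuousAt
  set L : EuclideanSpace ℝ (Fin d) → ℝ := fun w =>
    ∑ i, (G (w (p i).1 - w (p i).2) - z i * (w (p i).1 - w (p i).2)) with hL
  have hLc : Continuous L := by
    refine continuous_finsetSum _ fun i _ => ?_
    exact (hGc.comp (by fun_prop)).sub (by fun_prop)
  obtain ⟨x, hx, hmin⟩ := (isCompact_thurstoneSet d B).exists_isMinOn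
    ⟨0, zero_mem_thurstoneSet d hB⟩ hLc.continuousOn
  refine ⟨x, hx, fun v hv => ?_⟩
  -- Along the segment from the minimizer `x` to `v` the right difference quotients at 0 are
  -- nonnegative, so the derivative is too.
  set h : ℝ → ℝ := fun t => L (x + t • (v - x)) with hh
  have hd : HasDerivAt h (∑ i, (gaussCDF ((x (p i).1 - x (p i).2) / σ) - z i) *
      ((v (p i).1 - v (p i).2) - (x (p i).1 - x (p i).2))) 0 := by
    refine HasDerivAt.fun_sum fun i _ => ?_
    have h1 : HasDerivAt (fun t : ℝ => (x + t • (v - x)) (p i).1 - (x + t • (v - x)) (p i).2)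
        ((v (p i).1 - v (p i).2) - (x (p i).1 - x (p i).2)) 0 := by
      have h2 : (fun t : ℝ => (x + t • (v - x)) (p i).1 - (x + t • (v - x)) (p i).2) =
          fun t => (x (p i).1 - x (p i).2) +
            t * ((v (p i).1 - v (p i).2) - (x (p i).1 - x (p i).2)) := by
        funext t; simp; ring
      rw [h2]
      simpa using ((hasDerivAt_id (0 : ℝ)).mul_const
        ((v (p i).1 - v (p i).2) - (x (p i).1 - x (p i).2))).const_add (x (p i).1 - x (p i).2)
    have h3 : HasDerivAt G (gaussCDF ((x (p i).1 - x (p i).2) / σ))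
        ((x + (0 : ℝ) • (v - x)) (p i).1 - (x + (0 : ℝ) • (v - x)) (p i).2) := by
      simpa using hderiv (x (p i).1 - x (p i).2)
    have h4 := (h3.comp (0 : ℝ) h1).sub (h1.const_mul (z i))
    rw [sub_mul]
    exact h4
  refine ge_of_tendsto hd.tendsto_slope_zero_right ?_
  filter_upwards [Ioo_mem_nhdsGT (zero_lt_one' ℝ)] with t ht
  have hmem : x + t • (v - x) ∈ thurstoneSet d B :=
    (convex_thurstoneSet d B).add_smul_sub_mem hx hv ⟨ht.1.le, ht.2.le⟩
  have : L x ≤ L (x + t • (v - x)) := hmin hmem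
  simp only [hh, zero_add, zero_smul, add_zero, smul_eq_mul]
  exact mul_nonneg (inv_nonneg.2 ht.1.le) (sub_nonneg.2 this)

/-- The indicator that a comparison was won by its first item. -/
noncomputable def winIndicator (y : ℤˣ) : ℝ := if y = 1 then 1 else 0

@[simp] lemma winIndicator_one : winIndicator 1 = 1 := if_pos rfl

@[simp] lemma winIndicator_neg_one : winIndicator (-1) = 0 := if_neg (by decide)

/-- The signed incidence matrix of the comparison design. -/
noncomputable def incidence (p : Fin n → Fin d × Fin d) (i : Fin n) (j : Fin d) : ℝ :=
  (if (p i).1 = j then 1 else 0) - if (p i).2 = j then 1 else 0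

lemma sum_incidence_mul (p : Fin n → Fin d × Fin d) (v : Fin d → ℝ) (i : Fin n) :
    ∑ j, incidence p i j * v j = v (p i).1 - v (p i).2 := by
  simp [incidence, sub_mul, Finset.sum_sub_distrib]

lemma sum_incidence_sq (p : Fin n → Fin d × Fin d) (i : Fin n) (hi : (p i).1 ≠ (p i).2) :
    ∑ j, incidence p i j ^ 2 = 2 := by
  have := sum_incidence_mul p (incidence p i) i
  simp_rw [← sq] at this
  rw [this]
  simp [incidence, hi, hi.symm]
  norm_num

/-- The noise of the `j`-th score statistic: observed minus expected signed number of wins. -/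
noncomputable def scoreNoise (σ : ℝ) (p : Fin n → Fin d × Fin d) (w : EuclideanSpace ℝ (Fin d))
    (y : Fin n → ℤˣ) (j : Fin d) : ℝ :=
  ∑ i, incidence p i j * (winIndicator (y i) - gaussCDF ((w (p i).1 - w (p i).2) / σ))

/-- Adding the variational inequality to the strong monotonicity of `Φ` bounds a multiple of `∑ (v_a
- v_b)²`, for the error `v = x - w`, by the pairing of the score noise with `v`. The design turns
the left side into a multiple of `‖v‖²`, and Cauchy–Schwarz finishes. -/
lemma sq_dist_le_of_variational {σ B : ℝ} (hσ : 0 < σ) (hd : 2 ≤ d) (hn : 1 ≤ n)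
    {p : Fin n → Fin d × Fin d} (hp : IsUniformPairDesign p) (y : Fin n → ℤˣ)
    {x w : EuclideanSpace ℝ (Fin d)} (hx : x ∈ thurstoneSet d B) (hw : w ∈ thurstoneSet d B)
    (h : 0 ≤ ∑ i, (gaussCDF ((x (p i).1 - x (p i).2) / σ) - winIndicator (y i)) *
        ((w (p i).1 - w (p i).2) - (x (p i).1 - x (p i).2))) :
    ‖x - w‖ ^ 2 ≤ (3 * σ * (d - 1) / (2 * kappa B σ * n)) ^ 2 *
      ∑ j, scoreNoise σ p w y j ^ 2 := by
  have hκ := kappa_pos B σ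
  have hd' : (2 : ℝ) ≤ d := by exact_mod_cast hd
  have hn' : (1 : ℝ) ≤ n := by exact_mod_cast hn
  set v : Fin d → ℝ := fun j => x j - w j with hv
  have hnorm : ‖x - w‖ ^ 2 = ∑ j, v j ^ 2 := by simp [EuclideanSpace.norm_sq_eq, hv]
  have hv0 : ∑ j, v j = 0 := by simp [hv, Finset.sum_sub_distrib, hx.1, hw.1]
  have hnoise : ∑ j, scoreNoise σ p w y j * v j = ∑ i,
      (winIndicator (y i) - gaussCDF ((w (p i).1 - w (p i).2) / σ)) * (v (p i).1 - v (p i).2) := by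
    simp_rw [scoreNoise, Finset.sum_mul]
    rw [Finset.sum_comm]
    refine Finset.sum_congr rfl fun i _ => ?_
    rw [← sum_incidence_mul p v, Finset.mul_sum]
    exact Finset.sum_congr rfl fun j _ => by ring
  have hlow : ∑ i, kappa B σ / (3 * σ) * (v (p i).1 - v (p i).2) ^ 2 ≤
      ∑ j, scoreNoise σ p w y j * v j := by
    rw [hnoise, ← sub_nonneg]
    refine h.trans ?_
    rw [← Finset.sum_sub_distrib]
    refine Finset.sum_le_sum fun i _ => ?_
    have hmono := mul_sq_le_gaussCDF_sub_mul_sub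
      (abs_sub_div_le_of_mem_thurstoneSet hσ hx (p i).1 (p i).2)
      (abs_sub_div_le_of_mem_thurstoneSet hσ hw (p i).1 (p i).2)
    have e : (x (p i).1 - x (p i).2) / σ - (w (p i).1 - w (p i).2) / σ =
        (v (p i).1 - v (p i).2) / σ := by simp only [hv]; ring
    rw [e] at hmono
    have h2 := mul_le_mul_of_nonneg_right hmono hσ.le
    rw [mul_assoc _ (_ / σ) σ, div_mul_cancel₀ _ hσ.ne'] at h2
    have e2 : gaussCDF (2 * B / σ) * (1 - gaussCDF (2 * B / σ)) / 3 *
        ((v (p i).1 - v (p i).2) / σ) ^ 2 * σ =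
        kappa B σ / (3 * σ) * (v (p i).1 - v (p i).2) ^ 2 := by
      rw [kappa]; field_simp
    rw [e2] at h2
    have e3 : (w (p i).1 - w (p i).2) - (x (p i).1 - x (p i).2) =
      -(v (p i).1 - v (p i).2) := by simp only [hv]; ring
    rw [e3]
    linarith
  rw [← Finset.mul_sum, sum_sub_sq_eq_of_sum_eq_zero hd hp v hv0] at hlow
  have hcs := Finset.sum_mul_sq_le_sq_mul_sq Finset.univ (scoreNoise σ p w y) v
  rw [hnorm]
  set S := ∑ j, v j ^ 2
  set N := ∑ j, scoreNoise σ p w y j ^ 2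
  have hS : 0 ≤ S := Finset.sum_nonneg fun _ _ => sq_nonneg _
  have hN : 0 ≤ N := Finset.sum_nonneg fun _ _ => sq_nonneg _
  rcases hS.eq_or_lt with h0 | hSpos
  · rw [← h0]; positivity
  have hd1 : 0 < (d : ℝ) - 1 := by linarith
  set c := 3 * σ * (d - 1) / (2 * kappa B σ * n) with hc
  have hcpos : 0 < c := by positivity
  have e4 : kappa B σ / (3 * σ) * (2 * n / (d - 1) * S) = S / c := by
    rw [hc]; field_simp
  rw [e4] at hlow
  have h5 : (S / c) ^ 2 ≤ N * S := (pow_le_pow_left₀ (by positivity) hlow 2).trans hcs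
  rw [div_pow, div_le_iff₀ (by positivity)] at h5
  nlinarith

end VariationalEstimator

/-! ### Second moment of the score noise and the Thurstone upper bound -/

section ScoreVariance

variable {d n : ℕ}

/-- The summands are independent and centred, so variances add; a variable with values in `[0, 1]`
has variance at most `1/4`. -/
lemma integral_scoreNoise_sq_le {σ : ℝ} (hσ : 0 < σ) (p : Fin n → Fin d × Fin d)
    (w : EuclideanSpace ℝ (Fin d)) (j : Fin d) :
    ∫ y, scoreNoise σ p w y j ^ 2 ∂(thurstoneLaw σ p w) ≤ (∑ i, incidence p i j ^ 2) / 4 := by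
  rw [thurstoneLaw_eq_pi]
  set ν : Fin n → Measure ℤˣ := fun i => signLaw σ (w (p i).1 - w (p i).2) with hν
  set X : Fin n → ℤˣ → ℝ := fun i s => incidence p i j *
    (winIndicator s - gaussCDF ((w (p i).1 - w (p i).2) / σ)) with hX
  have hle : ∀ i, Var[X i; ν i] ≤ incidence p i j ^ 2 / 4 := by
    intro i
    have h1 : Var[X i; ν i] = incidence p i j ^ 2 * Var[winIndicator; ν i] := by
      rw [hX, variance_const_mul, variance_sub_const]
      exact (measurable_of_finite _).aestronglyMeasurable
    have h2 : Var[winIndicator; ν i] ≤ ((1 - 0) / 2) ^ 2 :=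
      variance_le_sq_of_bounded (ae_of_all _ fun s => by
        rcases Int.units_eq_one_or s with rfl | rfl <;> simp) (measurable_of_finite _).aemeasurable
    rw [h1]
    nlinarith [sq_nonneg (incidence p i j)]
  have hmean : ∀ i, ∫ s, X i s ∂(ν i) = 0 := by
    intro i
    rw [integral_signLaw hσ]
    simp [hX]; ring
  have hsum : ∫ y, (∑ i, fun y : Fin n → ℤˣ => X i (y i)) y ∂(Measure.pi ν) = 0 := by
    simp only [Finset.sum_apply]
    rw [integral_finsetSum _ fun i _ => Integrable.of_finite]
    refine Finset.sum_eq_zero fun i _ => ?_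
    rw [integral_comp_eval (measurable_of_finite _).aestronglyMeasurable, hmean]
  have hvar := variance_sum_pi (μ := ν) (X := X) fun i => MemLp.of_discrete
  rw [variance_eq_integral (measurable_of_finite _).aemeasurable, hsum] at hvar
  simp only [sub_zero, Finset.sum_apply] at hvar
  calc _ = ∑ i, Var[X i; ν i] := hvar
    _ ≤ ∑ i, incidence p i j ^ 2 / 4 := Finset.sum_le_sum fun i _ => hle i
    _ = _ := by rw [Finset.sum_div]

lemma integral_sum_scoreNoise_sq_le {σ : ℝ} (hσ : 0 < σ) {p : Fin n → Fin d × Fin d}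
    (hp : ∀ i, (p i).1 ≠ (p i).2) (w : EuclideanSpace ℝ (Fin d)) :
    ∫ y, ∑ j, scoreNoise σ p w y j ^ 2 ∂(thurstoneLaw σ p w) ≤ n / 2 := by
  rw [integral_finsetSum _ fun i _ => Integrable.of_finite]
  calc _ ≤ ∑ j, (∑ i, incidence p i j ^ 2) / 4 :=
        Finset.sum_le_sum fun j _ => integral_scoreNoise_sq_le hσ p w j
    _ = n / 2 := by
      rw [← Finset.sum_div, Finset.sum_comm]
      simp_rw [sum_incidence_sq p _ (hp _)]
      simp; ring

theorem thurstoneRisk_le {σ B : ℝ} (hσ : 0 < σ) (hB : 0 ≤ B) (hd : 2 ≤ d) (hn : 1 ≤ n)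
    {p : Fin n → Fin d × Fin d} (hp : IsUniformPairDesign p) :
    thurstoneRisk σ B p ≤
      ENNReal.ofReal (9 / (8 * kappa B σ ^ 2) * ((d - 1) ^ 2 * σ ^ 2 / n)) := by
  choose est hmem hvar using fun y : Fin n → ℤˣ =>
    exists_variational_solution (n := n) (d := d) σ hB p fun i => winIndicator (y i)
  refine iInf_le_of_le est (iInf_le_of_le (measurable_of_finite _) (iInf_le_of_le hmem ?_))
  refine iSup₂_le fun w hw => ?_
  have hκ := kappa_pos B σ
  have hn' : (1 : ℝ) ≤ n := by exact_mod_cast hn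
  set C := (3 * σ * (d - 1) / (2 * kappa B σ * n)) ^ 2 with hC
  calc _ ≤ ∫⁻ y, ENNReal.ofReal (C * ∑ j, scoreNoise σ p w y j ^ 2) ∂(thurstoneLaw σ p w) :=
        lintegral_mono fun y => ENNReal.ofReal_le_ofReal
          (sq_dist_le_of_variational hσ hd hn hp y (hmem y) hw (hvar y w hw))
    _ = ENNReal.ofReal (∫ y, C * ∑ j, scoreNoise σ p w y j ^ 2 ∂(thurstoneLaw σ p w)) :=
        (ofReal_integral_eq_lintegral_ofReal Integrable.of_finite (ae_of_all _ fun y =>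
          mul_nonneg (sq_nonneg _) (Finset.sum_nonneg fun _ _ => sq_nonneg _))).symm
    _ ≤ _ := by
      refine ENNReal.ofReal_le_ofReal ?_
      rw [integral_const_mul]
      refine (mul_le_mul_of_nonneg_left (integral_sum_scoreNoise_sq_le hσ hp.1 w)
        (sq_nonneg _)).trans (le_of_eq ?_)
      field_simp; ring

end ScoreVariance

/-! ### Hellinger affinity and the two-point bound -/

section Affinity

/-- The gap between the two means is `(√a - √b)²/2`; multiplying by `(√a + √b)² ≥ 2k` turns it into
a multiple of `(a - b)²`. -/
lemma add_div_two_sub_le_sqrt_mul {a b k : ℝ} (hk : 0 < k) (ha : k ≤ a) (hb : k ≤ b) :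
    (a + b) / 2 - (a - b) ^ 2 / (4 * k) ≤ √(a * b) := by
  have ha0 : 0 ≤ a := hk.le.trans ha
  have hb0 : 0 ≤ b := hk.le.trans hb
  rw [Real.sqrt_mul ha0]
  obtain ⟨s, hs, rfl⟩ : ∃ s, 0 ≤ s ∧ a = s ^ 2 := ⟨√a, Real.sqrt_nonneg a, (Real.sq_sqrt ha0).symm⟩
  obtain ⟨t, ht, rfl⟩ : ∃ t, 0 ≤ t ∧ b = t ^ 2 := ⟨√b, Real.sqrt_nonneg b, (Real.sq_sqrt hb0).symm⟩
  rw [Real.sqrt_sq hs, Real.sqrt_sq ht]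
  have h1 : (s - t) ^ 2 / 2 ≤ (s ^ 2 - t ^ 2) ^ 2 / (4 * k) := by
    rw [div_le_div_iff₀ (by norm_num) (by positivity)]
    have h2 : 2 * k ≤ (s + t) ^ 2 := by nlinarith [mul_nonneg hs ht]
    have h3 := mul_le_mul_of_nonneg_left h2 (sq_nonneg (s - t))
    nlinarith
  nlinarith

lemma sqrt_mul_le_add_div_two {a b : ℝ} (ha : 0 ≤ a) (hb : 0 ≤ b) : √(a * b) ≤ (a + b) / 2 := by
  rw [Real.sqrt_le_left (by linarith)]
  nlinarith [sq_nonneg (a - b)]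

lemma one_sub_sum_le_prod {ι : Type*} (s : Finset ι) (f g : ι → ℝ) (h0 : ∀ i, 0 ≤ f i)
    (h1 : ∀ i, f i ≤ 1) (hg : ∀ i, 1 - g i ≤ f i) : 1 - ∑ i ∈ s, g i ≤ ∏ i ∈ s, f i := by
  classical
  induction s using Finset.induction_on with
  | empty => simp
  | insert a s ha ih =>
    rw [Finset.sum_insert ha, Finset.prod_insert ha]
    have hp : ∏ i ∈ s, f i ≤ 1 := Finset.prod_le_one (fun i _ => h0 i) fun i _ => h1 i
    have hp0 : 0 ≤ ∏ i ∈ s, f i := Finset.prod_nonneg fun i _ => h0 i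
    nlinarith [h0 a, h1 a, hg a]

/-- A form of Le Cam's two-point bound. Expanding two squares with a weight `λ` eliminates the
estimate `e y` and leaves `(2λA - 2λ²)(u - v)²`, with `A` the affinity. At `A = 2/3` the best weight
is `λ = 1/3`, giving `2/9`. -/
lemma two_point_lower_bound {Y : Type*} [Fintype Y] {P Q : Y → ℝ} (hP : ∀ y, 0 ≤ P y)
    (hQ : ∀ y, 0 ≤ Q y) (hP1 : ∑ y, P y = 1) (hQ1 : ∑ y, Q y = 1)
    (hA : 2 / 3 ≤ ∑ y, √(P y * Q y)) (e : Y → ℝ) (u v : ℝ) :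
    2 / 9 * (u - v) ^ 2 ≤ ∑ y, P y * (e y - u) ^ 2 + ∑ y, Q y * (e y - v) ^ 2 := by
  have key : ∀ y, 2 / 3 * (u - v) ^ 2 * √(P y * Q y) - (u - v) ^ 2 / 9 * (P y + Q y) ≤
      P y * (e y - u) ^ 2 + Q y * (e y - v) ^ 2 := by
    intro y
    rw [Real.sqrt_mul (hP y)]
    have h1 := sq_nonneg (√(P y) * (u - e y) - (u - v) / 3 * √(Q y))
    have h2 := sq_nonneg (√(Q y) * (e y - v) - (u - v) / 3 * √(P y))
    have e1 := Real.sq_sqrt (hP y)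
    have e2 := Real.sq_sqrt (hQ y)
    generalize √(P y) = a at *
    generalize √(Q y) = b at *
    rw [← e1, ← e2]
    nlinarith
  have hs := Finset.sum_le_sum fun y (_ : y ∈ Finset.univ) => key y
  rw [Finset.sum_sub_distrib, ← Finset.mul_sum, ← Finset.mul_sum, Finset.sum_add_distrib,
    Finset.sum_add_distrib, hP1, hQ1] at hs
  nlinarith [sq_nonneg (u - v)]

variable {d n : ℕ}

lemma sum_sqrt_thurstonePMF_mul (σ : ℝ) (p : Fin n → Fin d × Fin d)
    (w v : EuclideanSpace ℝ (Fin d)) :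
    ∑ y, √(thurstonePMF σ p w y * thurstonePMF σ p v y) =
      ∏ i, (√(gaussCDF ((w (p i).1 - w (p i).2) / σ) * gaussCDF ((v (p i).1 - v (p i).2) / σ)) +
        √((1 - gaussCDF ((w (p i).1 - w (p i).2) / σ)) *
          (1 - gaussCDF ((v (p i).1 - v (p i).2) / σ)))) := by
  have h := sum_prod_signPMF fun i y =>
    √(signPMF (gaussCDF ((w (p i).1 - w (p i).2) / σ)) y *
      signPMF (gaussCDF ((v (p i).1 - v (p i).2) / σ)) y)
  simp only [signPMF_one, signPMF_neg_one] at h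
  rw [← h]
  refine Finset.sum_congr rfl fun y _ => ?_
  rw [thurstonePMF, thurstonePMF, ← Finset.prod_mul_distrib, Real.sqrt_prod _ fun i _ =>
    mul_nonneg (signPMF_gaussCDF_nonneg _ _) (signPMF_gaussCDF_nonneg _ _)]

lemma kappa_le_of_abs_le {B σ x : ℝ} (hx : |x| ≤ 2 * B / σ) :
    kappa B σ ≤ gaussCDF x ∧ kappa B σ ≤ 1 - gaussCDF x := by
  have h : kappa B σ ≤ _ := gaussCDF_mul_one_sub_le hx
  have h0 := gaussCDF_pos x
  have h1 := gaussCDF_lt_one x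
  constructor <;> nlinarith

/-- The affinity of product laws is a product. Each factor loses at most a multiple of the squared
change in the compared difference, since both outcomes have probability at least `κ`; the design
identity adds up the losses. -/
lemma one_sub_le_sum_sqrt_thurstonePMF_mul {σ B : ℝ} (hσ : 0 < σ) (hd : 2 ≤ d)
    {p : Fin n → Fin d × Fin d} (hp : IsUniformPairDesign p) {w v : EuclideanSpace ℝ (Fin d)}
    (hw : w ∈ thurstoneSet d B) (hv : v ∈ thurstoneSet d B) :
    1 - n / (6 * kappa B σ * σ ^ 2 * (d - 1)) * ∑ j, (w j - v j) ^ 2 ≤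
      ∑ y, √(thurstonePMF σ p w y * thurstonePMF σ p v y) := by
  have hκ := kappa_pos B σ
  have hd' : (2 : ℝ) ≤ d := by exact_mod_cast hd
  have hd1 : (d : ℝ) - 1 ≠ 0 := by linarith
  rw [sum_sqrt_thurstonePMF_mul]
  have hsum := sum_sub_sq_eq_of_sum_eq_zero hd hp (fun j => w j - v j)
    (by simp [Finset.sum_sub_distrib, hw.1, hv.1])
  have e : n / (6 * kappa B σ * σ ^ 2 * (d - 1)) * ∑ j, (w j - v j) ^ 2 =
      ∑ i, 1 / (12 * kappa B σ * σ ^ 2) *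
        ((w (p i).1 - v (p i).1) - (w (p i).2 - v (p i).2)) ^ 2 := by
    rw [← Finset.mul_sum, hsum]
    field_simp
    ring
  rw [e]
  refine one_sub_sum_le_prod _ _ _ (fun i => by positivity) (fun i => ?_) fun i => ?_
  all_goals
    set x := (w (p i).1 - w (p i).2) / σ with hx
    set y := (v (p i).1 - v (p i).2) / σ with hy
  · have h1 := sqrt_mul_le_add_div_two (gaussCDF_pos x).le (gaussCDF_pos y).le
    have h2 := sqrt_mul_le_add_div_two (sub_nonneg.2 (gaussCDF_lt_one x).le)
      (sub_nonneg.2 (gaussCDF_lt_one y).le)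
    linarith
  · obtain ⟨hx1, hx2⟩ := kappa_le_of_abs_le
      (abs_sub_div_le_of_mem_thurstoneSet hσ hw (p i).1 (p i).2)
    obtain ⟨hy1, hy2⟩ := kappa_le_of_abs_le
      (abs_sub_div_le_of_mem_thurstoneSet hσ hv (p i).1 (p i).2)
    have h1 := add_div_two_sub_le_sqrt_mul hκ hx1 hy1
    have h2 := add_div_two_sub_le_sqrt_mul hκ hx2 hy2
    rw [← hx, ← hy] at h1 h2
    have h3 : (1 - gaussCDF x - (1 - gaussCDF y)) ^ 2 = (gaussCDF x - gaussCDF y) ^ 2 := by ring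
    rw [h3] at h2
    have h4 : (gaussCDF x - gaussCDF y) ^ 2 / (4 * kappa B σ) ≤
        (x - y) ^ 2 / 6 / (4 * kappa B σ) := by
      gcongr; exact gaussCDF_sub_sq_le x y
    have h5 : 1 / (12 * kappa B σ * σ ^ 2) *
        ((w (p i).1 - v (p i).1) - (w (p i).2 - v (p i).2)) ^ 2 =
        2 * ((x - y) ^ 2 / 6 / (4 * kappa B σ)) := by
      rw [hx, hy]; field_simp; ring
    rw [h5]
    linarith

end Affinity

/-! ### Assouad's hypercube and the Thurstone lower bound -/

section Hypercube

variable {d n : ℕ}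

/-- The hypercube of parameters: consecutive coordinates `2 b`, `2 b + 1` carry opposite entries
`δ` and `-δ`, in an order determined by the `b`-th sign. -/
noncomputable def cubeVec (d : ℕ) (δ : ℝ) (s : Fin (d / 2) → ℤˣ) : EuclideanSpace ℝ (Fin d) :=
  WithLp.toLp 2 fun j => if h : (j : ℕ) / 2 < d / 2 then
    δ * ((s ⟨(j : ℕ) / 2, h⟩ : ℤ) : ℝ) * (-1) ^ (j : ℕ) else 0

lemma cubeVec_apply (δ : ℝ) (s : Fin (d / 2) → ℤˣ) (j : Fin d) :
    cubeVec d δ s j = if h : (j : ℕ) / 2 < d / 2 then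
      δ * ((s ⟨(j : ℕ) / 2, h⟩ : ℤ) : ℝ) * (-1) ^ (j : ℕ) else 0 := rfl

lemma abs_units_int_cast (a : ℤˣ) : |((a : ℤ) : ℝ)| = 1 := by
  rcases Int.units_eq_one_or a with rfl | rfl <;> simp

lemma sum_range_two_mul_eq_zero {g : ℕ → ℝ} (hg : ∀ b, g (2 * b) + g (2 * b + 1) = 0) (k : ℕ) :
    ∑ j ∈ Finset.range (2 * k), g j = 0 := by
  induction k with
  | zero => simp
  | succ k ih =>
    rw [show 2 * (k + 1) = 2 * k + 1 + 1 by ring, Finset.sum_range_succ, Finset.sum_range_succ, ih]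
    linarith [hg k]

lemma cubeVec_mem_thurstoneSet {δ B : ℝ} (hδ : 0 ≤ δ) (hB : δ ≤ B) (s : Fin (d / 2) → ℤˣ) :
    cubeVec d δ s ∈ thurstoneSet d B := by
  refine ⟨?_, fun j => ?_⟩
  · set g : ℕ → ℝ := fun j => if h : j / 2 < d / 2 then
      δ * ((s ⟨j / 2, h⟩ : ℤ) : ℝ) * (-1) ^ j else 0 with hg
    have hpair : ∀ b, g (2 * b) + g (2 * b + 1) = 0 := by
      intro b
      have e1 : 2 * b / 2 = b := by omega
      have e2 : (2 * b + 1) / 2 = b := by omega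
      simp only [hg, e1, e2]
      split_ifs
      · rw [pow_succ]; ring
      · simp
    have hsum : ∑ j, cubeVec d δ s j = ∑ j ∈ Finset.range d, g j := by
      rw [← Fin.sum_univ_eq_sum_range]; rfl
    rw [hsum]
    rcases Nat.even_or_odd' d with ⟨k, hk | hk⟩
    · rw [hk]; exact sum_range_two_mul_eq_zero hpair k
    -- For odd `d` the last coordinate has no partner and is set to 0.
    · rw [hk, Finset.sum_range_succ, sum_range_two_mul_eq_zero hpair k, zero_add]
      exact dif_neg (by omega)
  · rw [cubeVec_apply]
    split_ifs
    · rw [abs_mul, abs_mul, abs_units_int_cast, abs_pow, abs_neg, abs_one, one_pow, abs_of_nonneg hδ]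
      linarith
    · simpa using hδ.trans hB

/-- Flipping the `b`-th sign. -/
def flipSign {m : ℕ} (b : Fin m) (s : Fin m → ℤˣ) : Fin m → ℤˣ := Function.update s b (-s b)

lemma flipSign_involutive {m : ℕ} (b : Fin m) : Function.Involutive (flipSign b) := by
  intro s; simp [flipSign]

lemma cubeVec_sub_flipSign_sq (δ : ℝ) (b : Fin (d / 2)) (s : Fin (d / 2) → ℤˣ) (j : Fin d) :
    (cubeVec d δ s j - cubeVec d δ (flipSign b s) j) ^ 2 =
      if (j : ℕ) / 2 = b then 4 * δ ^ 2 else 0 := by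
  rw [cubeVec_apply, cubeVec_apply]
  by_cases h : (j : ℕ) / 2 < d / 2
  · rw [dif_pos h, dif_pos h]
    by_cases hb : (j : ℕ) / 2 = b
    · have : (⟨(j : ℕ) / 2, h⟩ : Fin (d / 2)) = b := Fin.ext hb
      rw [if_pos hb, this, flipSign, Function.update_self]
      have h1 : ((s b : ℤ) : ℝ) ^ 2 = 1 := by rw [← sq_abs, abs_units_int_cast, one_pow]
      have h2 : (((-1 : ℝ)) ^ (j : ℕ)) ^ 2 = 1 := by rw [← pow_mul, mul_comm, pow_mul]; simp
      push_cast
      linear_combination (4 * δ ^ 2 * ((-1 : ℝ) ^ (j : ℕ)) ^ 2) * h1 + 4 * δ ^ 2 * h2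
    · have : (⟨(j : ℕ) / 2, h⟩ : Fin (d / 2)) ≠ b := fun h => hb (congrArg Fin.val h)
      rw [if_neg hb, flipSign, Function.update_of_ne this]
      ring
  · rw [dif_neg h, dif_neg h, if_neg (by have := b.2; omega)]
    ring

lemma sum_cubeVec_sub_flipSign_sq_le (δ : ℝ) (b : Fin (d / 2)) (s : Fin (d / 2) → ℤˣ) :
    ∑ j, (cubeVec d δ s j - cubeVec d δ (flipSign b s) j) ^ 2 ≤ 8 * δ ^ 2 := by
  simp_rw [cubeVec_sub_flipSign_sq]
  rw [← Finset.sum_filter, Finset.sum_const, nsmul_eq_mul]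
  have hcard : (Finset.univ.filter fun j : Fin d => (j : ℕ) / 2 = b).card ≤ 2 := by
    refine (Finset.card_le_card_of_injOn (t := {2 * (b : ℕ), 2 * (b : ℕ) + 1}) Fin.val ?_
      Fin.val_injective.injOn).trans Finset.card_le_two
    intro j hj
    simp at hj ⊢
    omega
  have : ((Finset.univ.filter fun j : Fin d => (j : ℕ) / 2 = b).card : ℝ) ≤ 2 := by
    exact_mod_cast hcard
  nlinarith [sq_nonneg δ]

lemma sub_one_le_card_filter_div_two (d : ℕ) :
    (d : ℝ) - 1 ≤ ((Finset.univ.filter fun j : Fin d => (j : ℕ) / 2 < d / 2).card : ℝ) := by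
  have h := Finset.card_filter_add_card_filter_not (s := Finset.univ)
    fun j : Fin d => (j : ℕ) / 2 < d / 2
  have h2 : (Finset.univ.filter fun j : Fin d => ¬ (j : ℕ) / 2 < d / 2).card ≤ 1 := by
    refine Finset.card_le_one.2 fun a ha b hb => Fin.ext ?_
    simp at ha hb
    omega
  rw [Finset.card_univ, Fintype.card_fin] at h
  rw [sub_le_iff_le_add]
  exact_mod_cast (by omega : d ≤ _ + 1)

/-- A flip changes a paired coordinate by `2δ`, so the two-point bound gives `8/9 δ²` for a vertex
and its flip together, hence `4/9 δ²` on average over the cube. At least `d - 1` coordinates are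
paired, and some vertex attains at least the average total. -/
theorem le_sum_thurstonePMF_mul_sq_dist {σ B : ℝ} (hσ : 0 < σ) (hd : 2 ≤ d) (hn : 1 ≤ n)
    {p : Fin n → Fin d × Fin d} (hp : IsUniformPairDesign p) {δ : ℝ} (hδ : 0 ≤ δ) (hδB : δ ≤ B)
    (hδ2 : δ ^ 2 ≤ kappa B σ * σ ^ 2 * (d - 1) / (4 * n))
    (est : (Fin n → ℤˣ) → EuclideanSpace ℝ (Fin d)) :
    ∃ w ∈ thurstoneSet d B, (d - 1) * (4 / 9 * δ ^ 2) ≤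
      ∑ y, thurstonePMF σ p w y * ‖est y - w‖ ^ 2 := by
  have hκ := kappa_pos B σ
  have hd' : (2 : ℝ) ≤ d := by exact_mod_cast hd
  have hn' : (1 : ℝ) ≤ n := by exact_mod_cast hn
  have hd1 : 0 < (d : ℝ) - 1 := by linarith
  have hmem := cubeVec_mem_thurstoneSet (d := d) hδ hδB
  set F : Fin d → (Fin (d / 2) → ℤˣ) → ℝ := fun j s =>
    ∑ y, thurstonePMF σ p (cubeVec d δ s) y * (est y j - cubeVec d δ s j) ^ 2 with hF
  have hFnn : ∀ j s, 0 ≤ F j s := fun j s =>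
    Finset.sum_nonneg fun y _ => mul_nonneg (thurstonePMF_nonneg _ _ _ _) (sq_nonneg _)
  have hcoord : ∀ j : Fin d, (j : ℕ) / 2 < d / 2 → ∑ _s : Fin (d / 2) → ℤˣ, 4 / 9 * δ ^ 2 ≤
      ∑ s, F j s := by
    intro j hj
    set b : Fin (d / 2) := ⟨(j : ℕ) / 2, hj⟩ with hb
    have hflip : ∑ s, F j (flipSign b s) = ∑ s, F j s :=
      (flipSign_involutive b).bijective.sum_comp (F j)
    have hpair : ∀ s, 8 / 9 * δ ^ 2 ≤ F j s + F j (flipSign b s) := by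
      intro s
      have haff : 2 / 3 ≤ ∑ y, √(thurstonePMF σ p (cubeVec d δ s) y *
          thurstonePMF σ p (cubeVec d δ (flipSign b s)) y) := by
        refine le_trans ?_ (one_sub_le_sum_sqrt_thurstonePMF_mul hσ hd hp (hmem s)
          (hmem (flipSign b s)))
        have h1 : n / (6 * kappa B σ * σ ^ 2 * (d - 1)) *
            ∑ j, (cubeVec d δ s j - cubeVec d δ (flipSign b s) j) ^ 2 ≤
            n / (6 * kappa B σ * σ ^ 2 * (d - 1)) *
              (8 * (kappa B σ * σ ^ 2 * (d - 1) / (4 * n))) := by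
          refine mul_le_mul_of_nonneg_left ?_ (by positivity)
          exact (sum_cubeVec_sub_flipSign_sq_le δ b s).trans (by linarith)
        -- The bound imposed on `δ²` is exactly what makes the affinity loss at most `1/3`.
        have h2 : n / (6 * kappa B σ * σ ^ 2 * (d - 1)) *
              (8 * (kappa B σ * σ ^ 2 * (d - 1) / (4 * n))) = 1 / 3 := by
          field_simp; norm_num
        linarith
      have h := two_point_lower_bound (thurstonePMF_nonneg σ p _) (thurstonePMF_nonneg σ p _)
        (sum_thurstonePMF σ p _) (sum_thurstonePMF σ p _) haff (fun y => est y j)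
        (cubeVec d δ s j) (cubeVec d δ (flipSign b s) j)
      rw [cubeVec_sub_flipSign_sq, if_pos rfl] at h
      exact le_trans (by linarith) h
    have hs := Finset.sum_le_sum fun s (_ : s ∈ Finset.univ) => hpair s
    rw [Finset.sum_add_distrib, hflip] at hs
    have e : ∑ _s : Fin (d / 2) → ℤˣ, 8 / 9 * δ ^ 2 =
        2 * ∑ _s : Fin (d / 2) → ℤˣ, 4 / 9 * δ ^ 2 := by
      rw [Finset.mul_sum]; exact Finset.sum_congr rfl fun _ _ => by ring
    linarith
  have htotal : ∑ _s : Fin (d / 2) → ℤˣ, (d - 1) * (4 / 9 * δ ^ 2) ≤ ∑ s, ∑ j, F j s := by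
    rw [Finset.sum_comm, ← Finset.mul_sum]
    calc _ ≤ ((Finset.univ.filter fun j : Fin d => (j : ℕ) / 2 < d / 2).card : ℝ) *
          ∑ _s : Fin (d / 2) → ℤˣ, 4 / 9 * δ ^ 2 :=
          mul_le_mul_of_nonneg_right (sub_one_le_card_filter_div_two d)
            (Finset.sum_nonneg fun _ _ => by positivity)
      _ = ∑ j ∈ Finset.univ.filter fun j : Fin d => (j : ℕ) / 2 < d / 2,
          ∑ _s : Fin (d / 2) → ℤˣ, 4 / 9 * δ ^ 2 := by
          simp only [Finset.sum_const, nsmul_eq_mul]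
      _ ≤ ∑ j ∈ Finset.univ.filter fun j : Fin d => (j : ℕ) / 2 < d / 2, ∑ s, F j s :=
          Finset.sum_le_sum fun j hj => hcoord j (Finset.mem_filter.1 hj).2
      _ ≤ _ := Finset.sum_le_univ_sum_of_nonneg fun j => Finset.sum_nonneg fun s _ => hFnn j s
  obtain ⟨s, -, hs⟩ := Finset.exists_le_of_sum_le Finset.univ_nonempty htotal
  refine ⟨cubeVec d δ s, hmem s, hs.trans (le_of_eq ?_)⟩
  rw [hF, Finset.sum_comm]
  refine Finset.sum_congr rfl fun y _ => ?_
  rw [EuclideanSpace.norm_sq_eq, Finset.mul_sum]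
  simp

theorem le_thurstoneRisk {σ B : ℝ} (hσ : 0 < σ) (hd : 2 ≤ d) (hn : 1 ≤ n)
    {p : Fin n → Fin d × Fin d} (hp : IsUniformPairDesign p) {δ : ℝ} (hδ : 0 ≤ δ) (hδB : δ ≤ B)
    (hδ2 : δ ^ 2 ≤ kappa B σ * σ ^ 2 * (d - 1) / (4 * n)) :
    ENNReal.ofReal ((d - 1) * (4 / 9 * δ ^ 2)) ≤ thurstoneRisk σ B p := by
  refine le_iInf fun est => le_iInf fun _ => le_iInf fun _ => ?_
  obtain ⟨w, hw, h⟩ := le_sum_thurstonePMF_mul_sq_dist hσ hd hn hp hδ hδB hδ2 est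
  refine le_iSup₂_of_le w hw ?_
  rw [lintegral_thurstoneLaw hσ p w _ fun _ => sq_nonneg _]
  exact ENNReal.ofReal_le_ofReal h

end Hypercube

/-! ### Linear forms in Gaussian vectors: variance, covariance, independence -/

section GaussianLinearForms

lemma ofReal_variance_le_lintegral_sq_sub {Ω : Type*} {mΩ : MeasurableSpace Ω} {μ : Measure Ω}
    [IsProbabilityMeasure μ] {X : Ω → ℝ} (hX : MemLp X 2 μ) (c : ℝ) :
    ENNReal.ofReal Var[X; μ] ≤ ∫⁻ ω, ENNReal.ofReal ((c - X ω) ^ 2) ∂μ := by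
  have hc : MemLp (fun ω => X ω - c) 2 μ := hX.sub (memLp_const c)
  have h : ∀ ω, (c - X ω) ^ 2 = (X ω - c) ^ 2 := fun ω => by ring
  simp_rw [h]
  rw [← ofReal_integral_eq_lintegral_ofReal hc.integrable_sq (ae_of_all _ fun ω => sq_nonneg _),
    ← variance_sub_const hX.aestronglyMeasurable c]
  exact ENNReal.ofReal_le_ofReal (variance_le_expectation_sq hc.aestronglyMeasurable)

/-- By independence and Tonelli the value of `Z` can be frozen, and a constant predicts `X` no
better than its mean. No integrability of `Z` is required, so arbitrary measurable estimators are
covered. -/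
lemma ofReal_variance_le_lintegral_sq_sub_of_indepFun {Ω : Type*} {mΩ : MeasurableSpace Ω}
    {μ : Measure Ω} [IsProbabilityMeasure μ] {X Z : Ω → ℝ} (hX : MemLp X 2 μ)
    (hXm : Measurable X) (hZ : Measurable Z) (hXZ : IndepFun X Z μ) :
    ENNReal.ofReal Var[X; μ] ≤ ∫⁻ ω, ENNReal.ofReal ((Z ω - X ω) ^ 2) ∂μ := by
  have hm : Measurable fun q : ℝ × ℝ => ENNReal.ofReal ((q.2 - q.1) ^ 2) := by fun_prop
  have h1 : ∫⁻ ω, ENNReal.ofReal ((Z ω - X ω) ^ 2) ∂μ =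
      ∫⁻ z, ∫⁻ x, ENNReal.ofReal ((z - x) ^ 2) ∂(μ.map X) ∂(μ.map Z) := by
    rw [← lintegral_prod_symm' _ hm,
      ← (indepFun_iff_map_prod_eq_prod_map_map hXm.aemeasurable hZ.aemeasurable).1 hXZ,
      lintegral_map hm (hXm.prodMk hZ)]
  have hprob := Measure.isProbabilityMeasure_map (μ := μ) hZ.aemeasurable
  rw [h1]
  calc _ = ∫⁻ _z, ENNReal.ofReal Var[X; μ] ∂(μ.map Z) := by simp
    _ ≤ _ := lintegral_mono fun z => by
      rw [lintegral_map (by fun_prop) hXm]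
      exact ofReal_variance_le_lintegral_sq_sub hX z

instance (n : ℕ) (σ : ℝ) : IsProbabilityMeasure (noiseLaw n σ) := by
  rw [noiseLaw_eq_pi]; infer_instance

instance (n : ℕ) (σ : ℝ) : IsGaussian (noiseLaw n σ) := by
  have h := (iIndepFun_pi (μ := fun _ : Fin n => gaussianReal 0 (noiseVar σ)) (X := fun _ x => x)
    fun _ => aemeasurable_id).hasGaussianLaw fun i => HasLaw.hasGaussianLaw
      (μ := gaussianReal 0 (noiseVar σ)) ⟨(measurable_pi_apply i).aemeasurable,
        (measurePreserving_eval (fun _ : Fin n => gaussianReal 0 (noiseVar σ)) i).map_eq⟩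
  have h2 := h.isGaussian_map
  rwa [Measure.map_id'] at h2

variable {d n : ℕ}

lemma memLp_const_mul_gaussianReal (a σ : ℝ) :
    MemLp (fun x => a * x) 2 (gaussianReal 0 (noiseVar σ)) :=
  (memLp_id_gaussianReal' 2 (by simp)).const_mul a

lemma memLp_sum_mul_noiseLaw (σ : ℝ) (a : Fin n → ℝ) :
    MemLp (fun ε : Fin n → ℝ => ∑ i, a i * ε i) 2 (noiseLaw n σ) :=
  memLp_finsetSum _ fun i _ => (memLp_const_mul_gaussianReal (a i) σ).comp_measurePreserving
    (measurePreserving_eval (fun _ : Fin n => gaussianReal 0 (noiseVar σ)) i)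

lemma variance_sum_mul_noiseLaw (σ : ℝ) (a : Fin n → ℝ) :
    Var[fun ε : Fin n → ℝ => ∑ i, a i * ε i; noiseLaw n σ] = σ ^ 2 * ∑ i, a i ^ 2 := by
  have h := variance_sum_pi (μ := fun _ : Fin n => gaussianReal 0 (noiseVar σ))
    (X := fun i x => a i * x) fun i => memLp_const_mul_gaussianReal (a i) σ
  have e : (∑ i, fun ε : Fin n → ℝ => a i * ε i) = fun ε => ∑ i, a i * ε i := by
    ext; simp
  rw [e] at h
  rw [noiseLaw_eq_pi, h, Finset.mul_sum]
  refine Finset.sum_congr rfl fun i _ => ?_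
  rw [variance_const_mul, variance_fun_id_gaussianReal, coe_noiseVar, mul_comm]

lemma integral_sum_mul_noiseLaw (σ : ℝ) (a : Fin n → ℝ) :
    ∫ ε : Fin n → ℝ, ∑ i, a i * ε i ∂(noiseLaw n σ) = 0 := by
  rw [noiseLaw_eq_pi, integral_finsetSum]
  · refine Finset.sum_eq_zero fun i _ => ?_
    rw [integral_comp_eval (μ := fun _ : Fin n => gaussianReal 0 (noiseVar σ))
      (f := fun x => a i * x) (by fun_prop), integral_const_mul, integral_id_gaussianReal, mul_zero]
  · exact fun i _ => ((memLp_const_mul_gaussianReal (a i) σ).comp_measurePreserving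
      (measurePreserving_eval (fun _ : Fin n => gaussianReal 0 (noiseVar σ)) i)).integrable
      one_le_two

lemma lintegral_sum_mul_sq_noiseLaw (σ : ℝ) (a : Fin n → ℝ) :
    ∫⁻ ε : Fin n → ℝ, ENNReal.ofReal ((∑ i, a i * ε i) ^ 2) ∂(noiseLaw n σ) =
      ENNReal.ofReal (σ ^ 2 * ∑ i, a i ^ 2) := by
  rw [← ofReal_integral_eq_lintegral_ofReal (memLp_sum_mul_noiseLaw σ a).integrable_sq
    (ae_of_all _ fun _ => sq_nonneg _), ← variance_sum_mul_noiseLaw,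
    variance_eq_integral (memLp_sum_mul_noiseLaw σ a).aestronglyMeasurable.aemeasurable,
    integral_sum_mul_noiseLaw]
  simp

/-- A linear form in a pair of vectors. -/
def pairForm (a : Fin d → ℝ) (b : Fin n → ℝ) (ω : (Fin d → ℝ) × (Fin n → ℝ)) : ℝ :=
  ∑ j, a j * ω.1 j + ∑ i, b i * ω.2 i

lemma measurable_pairForm (a : Fin d → ℝ) (b : Fin n → ℝ) : Measurable (pairForm a b) := by
  unfold pairForm; fun_prop

lemma memLp_pairForm (τ σ : ℝ) (a : Fin d → ℝ) (b : Fin n → ℝ) :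
    MemLp (pairForm a b) 2 ((noiseLaw d τ).prod (noiseLaw n σ)) :=
  ((memLp_sum_mul_noiseLaw τ a).comp_fst _).add ((memLp_sum_mul_noiseLaw σ b).comp_snd _)

lemma variance_pairForm (τ σ : ℝ) (a : Fin d → ℝ) (b : Fin n → ℝ) :
    Var[pairForm a b; (noiseLaw d τ).prod (noiseLaw n σ)] =
      τ ^ 2 * ∑ j, a j ^ 2 + σ ^ 2 * ∑ i, b i ^ 2 := by
  rw [← variance_sum_mul_noiseLaw τ a, ← variance_sum_mul_noiseLaw σ b]
  exact variance_add_prod (X := fun w : Fin d → ℝ => ∑ j, a j * w j)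
    (Y := fun ε : Fin n → ℝ => ∑ i, b i * ε i)
    (memLp_sum_mul_noiseLaw τ a) (memLp_sum_mul_noiseLaw σ b)

lemma covariance_pairForm (τ σ : ℝ) (a a' : Fin d → ℝ) (b b' : Fin n → ℝ) :
    cov[pairForm a b, pairForm a' b'; (noiseLaw d τ).prod (noiseLaw n σ)] =
      τ ^ 2 * ∑ j, a j * a' j + σ ^ 2 * ∑ i, b i * b' i := by
  -- Polarization: the covariance is read off from the variance of the sum, which is again a linear
  -- form.
  have h := variance_add (memLp_pairForm τ σ a b) (memLp_pairForm τ σ a' b')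
  have e : pairForm a b + pairForm a' b' = pairForm (a + a') (b + b') := by
    funext ω
    simp only [Pi.add_apply, pairForm, add_mul, Finset.sum_add_distrib]
    ring
  rw [e, variance_pairForm, variance_pairForm, variance_pairForm] at h
  simp only [Pi.add_apply, add_sq, Finset.sum_add_distrib, mul_assoc, ← Finset.mul_sum] at h
  linarith

/-- The hypothesis says that the covariances vanish; for jointly Gaussian forms this already gives
independence from the whole family. -/
lemma indepFun_pairForm {τ σ : ℝ} {a : Fin d → ℝ} {b : Fin n → ℝ} {A : Fin n → Fin d → ℝ}
    {C : Fin n → Fin n → ℝ}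
    (h : ∀ i, τ ^ 2 * ∑ j, a j * A i j + σ ^ 2 * ∑ l, b l * C i l = 0) :
    IndepFun (pairForm a b) (fun ω i => pairForm (A i) (C i) ω)
      ((noiseLaw d τ).prod (noiseLaw n σ)) := by
  have hcont : ∀ (a : Fin d → ℝ) (b : Fin n → ℝ), Continuous (pairForm a b) := fun a b => by
    unfold pairForm; fun_prop
  let L : ((Fin d → ℝ) × (Fin n → ℝ)) →L[ℝ] (Unit → ℝ) × (Fin n → ℝ) :=
    { toFun := fun ω => (fun _ => pairForm a b ω, fun i => pairForm (A i) (C i) ω)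
      map_add' := fun x y => by
        ext <;> simp [pairForm, mul_add, Finset.sum_add_distrib] <;> ring
      map_smul' := fun c x => by
        ext <;> simp [pairForm, mul_add, Finset.mul_sum, mul_left_comm]
      cont := (continuous_pi fun _ => hcont a b).prodMk (continuous_pi fun i => hcont _ _) }
  have hG : HasGaussianLaw (fun ω => ((fun _ : Unit => pairForm a b ω),
      fun i => pairForm (A i) (C i) ω)) ((noiseLaw d τ).prod (noiseLaw n σ)) :=
    IsGaussian.hasGaussianLaw_id.map L
  have hI := hG.indepFun_of_covariance_eval (X := fun _ : Unit => pairForm a b)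
    (Y := fun i => pairForm (A i) (C i)) fun _ i => by rw [covariance_pairForm, h]
  have hm : Measurable fun x : Unit → ℝ => x () := measurable_pi_apply ()
  exact hI.comp hm measurable_id

end GaussianLinearForms

/-! ### Exact minimax risk of the Cardinal model -/

section Cardinal

variable {d n : ℕ}

lemma cardinalLaw_eq_map (σ : ℝ) (u : Fin n → Fin d) (w : EuclideanSpace ℝ (Fin d)) :
    cardinalLaw σ u w = (noiseLaw n σ).map fun ε i => w (u i) + ε i := by
  simp only [cardinalLaw, inner_coordVec]

lemma lintegral_cardinalLaw (σ : ℝ) (u : Fin n → Fin d) (w : EuclideanSpace ℝ (Fin d))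
    {est : (Fin n → ℝ) → EuclideanSpace ℝ (Fin d)} (hest : Measurable est) :
    ∫⁻ y, ENNReal.ofReal (‖est y - w‖ ^ 2) ∂(cardinalLaw σ u w) =
      ∫⁻ ε, ∑ j, ENNReal.ofReal ((est (fun i => w (u i) + ε i) j - w j) ^ 2) ∂(noiseLaw n σ) := by
  rw [cardinalLaw_eq_map, lintegral_map (by fun_prop) (by fun_prop)]
  refine lintegral_congr fun ε => ?_
  rw [← ENNReal.ofReal_sum_of_nonneg fun _ _ => sq_nonneg _, EuclideanSpace.norm_sq_eq]
  simp

lemma sum_ite_sq_of_isUniformCoordDesign {u : Fin n → Fin d} (hu : IsUniformCoordDesign u)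
    (j : Fin d) (c : ℝ) : ∑ i, (if u i = j then c else 0) ^ 2 = n / d * c ^ 2 := by
  rw [← hu j, ← nsmul_eq_mul, ← Finset.sum_const, Finset.sum_filter]
  exact Finset.sum_congr rfl fun i _ => by split_ifs <;> simp

theorem cardinalRisk_le (σ : ℝ) {u : Fin n → Fin d} (hd : 1 ≤ d) (hn : 1 ≤ n)
    (hu : IsUniformCoordDesign u) :
    cardinalRisk σ u ≤ ENNReal.ofReal (d * (d * σ ^ 2 / n)) := by
  have hd' : (d : ℝ) ≠ 0 := by positivity
  have hn' : (n : ℝ) ≠ 0 := by positivity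
  have hest : Measurable fun y : Fin n → ℝ =>
      (WithLp.toLp 2 fun j : Fin d => ∑ i, (if u i = j then (d : ℝ) / n else 0) * y i :
        EuclideanSpace ℝ (Fin d)) := by fun_prop
  refine iInf_le_of_le _ (iInf_le_of_le hest (iInf_le_of_le (fun _ => trivial) ?_))
  refine iSup₂_le fun w _ => ?_
  rw [lintegral_cardinalLaw σ u w hest, lintegral_finsetSum _ fun j _ => by fun_prop]
  have herr : ∀ (ε : Fin n → ℝ) (j : Fin d),
      ∑ i, (if u i = j then (d : ℝ) / n else 0) * (w (u i) + ε i) - w j =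
        ∑ i, (if u i = j then (d : ℝ) / n else 0) * ε i := by
    intro ε j
    have h1 : ∑ i, (if u i = j then (d : ℝ) / n else 0) * w (u i) = w j := by
      have : ∀ i, (if u i = j then (d : ℝ) / n else 0) * w (u i) =
          if u i = j then (d : ℝ) / n * w j else 0 := fun i => by
        split_ifs with h <;> simp [h]
      simp_rw [this]
      rw [← Finset.sum_filter, Finset.sum_const, nsmul_eq_mul, hu j]
      field_simp
    simp_rw [mul_add, Finset.sum_add_distrib, h1]
    ring
  simp only [herr, lintegral_sum_mul_sq_noiseLaw, sum_ite_sq_of_isUniformCoordDesign hu]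
  rw [Finset.sum_const, Finset.card_univ, Fintype.card_fin, nsmul_eq_mul,
    ENNReal.ofReal_mul (Nat.cast_nonneg d), ENNReal.ofReal_natCast]
  refine le_of_eq ?_
  congr 2
  field_simp

/-- Here `noiseLaw d τ` serves as the prior on the parameter. The estimation error is a function of
the data minus the posterior residual, and that residual is independent of the data, so the risk is
at least its variance. -/
lemma le_lintegral_bayes_coord {σ τ : ℝ} (hσ : 0 < σ) (hτ : 0 < τ) {u : Fin n → Fin d}
    (hu : IsUniformCoordDesign u) {g : (Fin n → ℝ) → ℝ} (hg : Measurable g) (j : Fin d) :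
    ENNReal.ofReal (σ ^ 2 * τ ^ 2 / (n / d * τ ^ 2 + σ ^ 2)) ≤
      ∫⁻ ω, ENNReal.ofReal ((g (fun i => ω.1 (u i) + ω.2 i) - ω.1 j) ^ 2)
        ∂((noiseLaw d τ).prod (noiseLaw n σ)) := by
  set k : ℝ := n / d with hk
  have hk0 : 0 ≤ k := by positivity
  have hD : k * τ ^ 2 + σ ^ 2 ≠ 0 := by positivity
  -- The posterior mean of coordinate `j` is `a` times the sum of its observations; `α` and `β`
  -- below are the coefficients of the residual on parameter and noise.
  set a : ℝ := τ ^ 2 / (k * τ ^ 2 + σ ^ 2) with ha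
  have hak : 1 - k * a = σ ^ 2 / (k * τ ^ 2 + σ ^ 2) := by rw [ha]; field_simp; ring
  set α : Fin d → ℝ := fun l => if l = j then 1 - k * a else 0 with hα
  set β : Fin n → ℝ := fun i => if u i = j then -a else 0 with hβ
  set A : Fin n → Fin d → ℝ := fun i l => if l = u i then 1 else 0 with hA
  set C : Fin n → Fin n → ℝ := fun i l => if l = i then 1 else 0 with hC
  have hY : ∀ (ω : (Fin d → ℝ) × (Fin n → ℝ)) i, pairForm (A i) (C i) ω = ω.1 (u i) + ω.2 i := by
    intro ω i; simp [pairForm, hA, hC]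
  have hS : ∀ ω : (Fin d → ℝ) × (Fin n → ℝ), pairForm α β ω =
      ω.1 j - ∑ i, (if u i = j then a else 0) * (ω.1 (u i) + ω.2 i) := by
    intro ω
    have h1 : ∑ i, (if u i = j then a else 0) * ω.1 (u i) = k * a * ω.1 j := by
      have : ∀ i, (if u i = j then a else 0) * ω.1 (u i) =
          if u i = j then a * ω.1 j else 0 := fun i => by
        split_ifs with h <;> simp [h]
      simp_rw [this]
      rw [← Finset.sum_filter, Finset.sum_const, nsmul_eq_mul, hu j]
      ring
    have h2 : ∑ i, β i * ω.2 i = -∑ i, (if u i = j then a else 0) * ω.2 i := by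
      rw [← Finset.sum_neg_distrib]
      exact Finset.sum_congr rfl fun i _ => by simp only [hβ]; split_ifs <;> ring
    simp_rw [mul_add, Finset.sum_add_distrib, h1]
    rw [pairForm, h2]
    simp [hα]
    ring
  have hind : IndepFun (pairForm α β) (fun ω i => pairForm (A i) (C i) ω)
      ((noiseLaw d τ).prod (noiseLaw n σ)) := by
    refine indepFun_pairForm fun i => ?_
    simp only [hA, hC, mul_ite, mul_one, mul_zero, Finset.sum_ite_eq', Finset.mem_univ, if_true,
      hα, hβ]
    split_ifs
    · rw [hak, ha]; field_simp; ring
    · simp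
  -- Removing the posterior mean from the estimate leaves a function of the data that is compared
  -- with the residual.
  set h : (Fin n → ℝ) → ℝ := fun y => g y - ∑ i, (if u i = j then a else 0) * y i with hh
  have hm : Measurable h := by fun_prop
  have hYm : Measurable fun (ω : (Fin d → ℝ) × (Fin n → ℝ)) i => pairForm (A i) (C i) ω :=
    measurable_pi_lambda _ fun i => measurable_pairForm _ _
  have key := ofReal_variance_le_lintegral_sq_sub_of_indepFun (memLp_pairForm τ σ α β)
    (measurable_pairForm α β) (hm.comp hYm) (hind.comp measurable_id hm)
  have hvar : Var[pairForm α β; (noiseLaw d τ).prod (noiseLaw n σ)] =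
      σ ^ 2 * τ ^ 2 / (k * τ ^ 2 + σ ^ 2) := by
    rw [variance_pairForm, sum_ite_sq_of_isUniformCoordDesign hu, ← hk]
    simp only [hα, ite_pow, ne_eq, OfNat.ofNat_ne_zero, not_false_eq_true, zero_pow,
      Finset.sum_ite_eq', Finset.mem_univ, if_true]
    rw [hak, ha]
    field_simp
    ring
  rw [hvar] at key
  refine key.trans (le_of_eq (lintegral_congr fun ω => ?_))
  simp only [Function.comp_apply, hh, hY, hS]
  congr 2
  ring

/-- A supremum over parameters dominates the average under any prior, and the Bayes risk splits over
coordinates. -/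
lemma le_cardinalRisk_of_prior {σ τ : ℝ} (hσ : 0 < σ) (hτ : 0 < τ) {u : Fin n → Fin d}
    (hu : IsUniformCoordDesign u) :
    ENNReal.ofReal (d * (σ ^ 2 * τ ^ 2 / (n / d * τ ^ 2 + σ ^ 2))) ≤ cardinalRisk σ u := by
  refine le_iInf fun est => le_iInf fun hest => le_iInf fun _ => ?_
  set R := ⨆ w ∈ (Set.univ : Set (EuclideanSpace ℝ (Fin d))),
    ∫⁻ y, ENNReal.ofReal (‖est y - w‖ ^ 2) ∂(cardinalLaw σ u w)
  have hm : ∀ j, Measurable fun ω : (Fin d → ℝ) × (Fin n → ℝ) =>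
      ENNReal.ofReal ((est (fun i => ω.1 (u i) + ω.2 i) j - ω.1 j) ^ 2) := by
    intro j; fun_prop
  calc _ = ∑ _j : Fin d, ENNReal.ofReal (σ ^ 2 * τ ^ 2 / (n / d * τ ^ 2 + σ ^ 2)) := by
        rw [Finset.sum_const, Finset.card_univ, Fintype.card_fin, nsmul_eq_mul,
          ENNReal.ofReal_mul (Nat.cast_nonneg d), ENNReal.ofReal_natCast]
    _ ≤ ∑ j, ∫⁻ ω, ENNReal.ofReal ((est (fun i => ω.1 (u i) + ω.2 i) j - ω.1 j) ^ 2)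
        ∂((noiseLaw d τ).prod (noiseLaw n σ)) :=
        Finset.sum_le_sum fun j _ =>
          le_lintegral_bayes_coord hσ hτ hu (g := fun y => est y j) (by fun_prop) j
    _ = ∫⁻ w, ∫⁻ ε, ∑ j, ENNReal.ofReal ((est (fun i => w (u i) + ε i) j - w j) ^ 2)
        ∂(noiseLaw n σ) ∂(noiseLaw d τ) := by
        rw [← lintegral_finsetSum _ fun j _ => hm j,
          lintegral_prod _ (Finset.measurable_fun_sum _ fun j _ => hm j).aemeasurable]
    _ ≤ ∫⁻ _w, R ∂(noiseLaw d τ) := lintegral_mono fun w => by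
        have h := lintegral_cardinalLaw σ u (WithLp.toLp 2 w) hest
        refine (le_of_eq h.symm).trans ?_
        exact le_iSup₂ (f := fun w (_ : w ∈ (Set.univ : Set (EuclideanSpace ℝ (Fin d)))) =>
          ∫⁻ y, ENNReal.ofReal (‖est y - w‖ ^ 2) ∂(cardinalLaw σ u w)) _ trivial
    _ = R := by simp

theorem le_cardinalRisk {σ : ℝ} (hσ : 0 < σ) {u : Fin n → Fin d} (hd : 1 ≤ d) (hn : 1 ≤ n)
    (hu : IsUniformCoordDesign u) :
    ENNReal.ofReal (d * (d * σ ^ 2 / n)) ≤ cardinalRisk σ u := by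
  have hd' : (0 : ℝ) < d := by positivity
  have hn' : (0 : ℝ) < n := by positivity
  -- The prior becomes flat: `ρ = 1/τ` tends to 0 from the right.
  have hlim : Filter.Tendsto (fun ρ : ℝ => ENNReal.ofReal (d * (σ ^ 2 / (n / d + σ ^ 2 * ρ ^ 2))))
      (nhdsWithin 0 (Set.Ioi 0)) (nhds (ENNReal.ofReal (d * (d * σ ^ 2 / n)))) := by
    refine (ENNReal.tendsto_ofReal ?_).mono_left nhdsWithin_le_nhds
    have hc : ContinuousAt (fun ρ : ℝ => d * (σ ^ 2 / (n / d + σ ^ 2 * ρ ^ 2))) 0 := by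
      have : (n : ℝ) / d + σ ^ 2 * 0 ^ 2 ≠ 0 := by positivity
      fun_prop (disch := assumption)
    have e : (d : ℝ) * (d * σ ^ 2 / n) = d * (σ ^ 2 / (n / d + σ ^ 2 * 0 ^ 2)) := by
      field_simp; ring
    rw [e]
    exact hc
  refine le_of_tendsto hlim ?_
  filter_upwards [self_mem_nhdsWithin] with ρ hρ
  have hρ' : 0 < ρ := hρ
  refine le_trans (le_of_eq ?_) (le_cardinalRisk_of_prior hσ (inv_pos.2 hρ') hu)
  congr 2
  field_simp

end Cardinal

/-! ### Division of the risk by the dimension -/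

section Normalization

lemma ofReal_le_div_natCast {d : ℕ} (hd : d ≠ 0) {x : ℝ} {R : ENNReal}
    (h : ENNReal.ofReal (d * x) ≤ R) : ENNReal.ofReal x ≤ R / (d : ENNReal) := by
  rw [ENNReal.le_div_iff_mul_le (Or.inl (by exact_mod_cast hd)) (Or.inl (ENNReal.natCast_ne_top d)),
    mul_comm, ← ENNReal.ofReal_natCast, ← ENNReal.ofReal_mul (Nat.cast_nonneg d)]
  exact h

lemma div_natCast_le_ofReal {d : ℕ} (hd : d ≠ 0) {x : ℝ} {R : ENNReal}
    (h : R ≤ ENNReal.ofReal (d * x)) : R / (d : ENNReal) ≤ ENNReal.ofReal x := by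
  rw [ENNReal.div_le_iff_le_mul (Or.inl (by exact_mod_cast hd)) (Or.inl (ENNReal.natCast_ne_top d)),
    mul_comm, ← ENNReal.ofReal_natCast, ← ENNReal.ofReal_mul (Nat.cast_nonneg d)]
  exact h

end Normalization

end CardinalOrdinal

theorem theorem1 :
    (∀ (d n : ℕ) (σ_c : ℝ) (u : Fin n → Fin d), 1 ≤ d → 1 ≤ n → 0 < σ_c →
      CardinalOrdinal.IsUniformCoordDesign u →
      CardinalOrdinal.cardinalRisk σ_c u / (d : ENNReal) =
        ENNReal.ofReal ((d : ℝ) * σ_c ^ 2 / (n : ℝ))) ∧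
    (∀ (d n : ℕ) (σ_o B : ℝ) (p : Fin n → Fin d × Fin d), 2 ≤ d → 1 ≤ n → 0 < σ_o → 0 < B →
      CardinalOrdinal.IsUniformPairDesign p →
      σ_o ^ 2 * CardinalOrdinal.kappa B σ_o * ((d : ℝ) - 1) ^ 2 / (0.07 * B ^ 2) ≤ (n : ℝ) →
      ENNReal.ofReal
          (0.0008 * CardinalOrdinal.kappa B σ_o * ((d : ℝ) * σ_o ^ 2 / (n : ℝ))) ≤
        CardinalOrdinal.thurstoneRisk σ_o B p / (d : ENNReal) ∧
      CardinalOrdinal.thurstoneRisk σ_o B p / (d : ENNReal) ≤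
        ENNReal.ofReal
          (5 / CardinalOrdinal.kappa B σ_o ^ 2 * ((d : ℝ) * σ_o ^ 2 / (n : ℝ)))) := by
  refine ⟨fun d n σ u hd hn hσ hu => le_antisymm ?_ ?_, fun d n σ B p hd hn hσ hB hp hnB => ?_⟩
  · exact CardinalOrdinal.div_natCast_le_ofReal (by omega)
      (CardinalOrdinal.cardinalRisk_le σ hd hn hu)
  · exact CardinalOrdinal.ofReal_le_div_natCast (by omega)
      (CardinalOrdinal.le_cardinalRisk hσ hd hn hu)
  have hκ := CardinalOrdinal.kappa_pos B σ
  have hd' : (2 : ℝ) ≤ d := by exact_mod_cast hd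
  have hn' : (0 : ℝ) < n := by positivity
  set κ := CardinalOrdinal.kappa B σ with hκdef
  have hκσ : 0 < κ * σ ^ 2 := by positivity
  refine ⟨CardinalOrdinal.ofReal_le_div_natCast (by omega) ?_,
    CardinalOrdinal.div_natCast_le_ofReal (by omega) ?_⟩
  · have hv : 0 ≤ κ * σ ^ 2 * (d - 1) / (4 * n) :=
      div_nonneg (mul_nonneg hκσ.le (by linarith)) (by positivity)
    -- The largest `δ` allowed by the affinity condition is taken; the sample-size hypothesis keeps
    -- it below `B`, since `d - 1 ≤ (d - 1)²` and `0.07 ≤ 4`.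
    have hle : √(κ * σ ^ 2 * (d - 1) / (4 * n)) ≤ B := by
      rw [Real.sqrt_le_left hB.le, div_le_iff₀ (by positivity)]
      rw [div_le_iff₀ (by positivity)] at hnB
      have h1 : κ * σ ^ 2 * (d - 1) ≤ σ ^ 2 * κ * ((d : ℝ) - 1) ^ 2 := by
        have : (d : ℝ) - 1 ≤ (d - 1) ^ 2 := by nlinarith
        nlinarith
      nlinarith [mul_pos hn' (pow_pos hB 2)]
    refine le_trans (ENNReal.ofReal_le_ofReal ?_) (CardinalOrdinal.le_thurstoneRisk hσ hd hn hp
      (Real.sqrt_nonneg _) hle (Real.sq_sqrt hv).le)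
    rw [Real.sq_sqrt hv]
    have e1 : (d : ℝ) * (0.0008 * κ * (d * σ ^ 2 / n)) = κ * σ ^ 2 / n * (0.0008 * d ^ 2) := by ring
    have e2 : ((d : ℝ) - 1) * (4 / 9 * (κ * σ ^ 2 * (d - 1) / (4 * n))) =
        κ * σ ^ 2 / n * (1 / 9 * (d - 1) ^ 2) := by field_simp
    rw [e1, e2]
    refine mul_le_mul_of_nonneg_left ?_ (by positivity)
    -- For `d ≥ 2` one has `(d - 1)² ≥ d²/4`, so `1/9 · (d - 1)²` exceeds `0.0008 d²` with ample
    -- room.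
    nlinarith
  · refine (CardinalOrdinal.thurstoneRisk_le hσ hB.le hd hn hp).trans
      (ENNReal.ofReal_le_ofReal ?_)
    rw [← hκdef]
    have e1 : (d : ℝ) * (5 / κ ^ 2 * (d * σ ^ 2 / n)) = σ ^ 2 / (n * κ ^ 2) * (5 * d ^ 2) := by
      field_simp
    have e2 : 9 / (8 * κ ^ 2) * (((d : ℝ) - 1) ^ 2 * σ ^ 2 / n) =
        σ ^ 2 / (n * κ ^ 2) * (9 / 8 * (d - 1) ^ 2) := by field_simp
    rw [e1, e2]
    refine mul_le_mul_of_nonneg_left ?_ (by positivity)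
    nlinarith
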